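/- **Setting.** Fix $q \in \mathbb{C}\setminus\{0\}$, put $\nu = -q-q^{-1}$, and let $\varsigma=(s_1,\dots,s_d)$ be a multiindex of nonnegative integers with $n=s_1+\dots+s_d$. Let $\mathfrak{p}(q)=p$ if $q=e^{\pi i p'/p}$ with coprime integers $p,p'>0$, let $\mathfrak{p}(q)=\infty$ if $q$ is not a root of unity, and let $\bar{\mathfrak{p}}(q)=\infty$ for $q=\pm1$ and $\bar{\mathfrak{p}}(q)=\mathfrak{p}(q)$ otherwise. An $(n,m)$-link diagram is a planar (non-crossing) pairing of $n$ nodes on a left vertical line and $m$ nodes on a right vertical line by links drawn between the lines. Formal complex linear combinations of them (tangles) are composed by concatenation, each closed loop being replaced by the factor $\nu$; for $n=m$ this gives the Temperley–Lieb algebra $\mathsf{TL}_n(\nu)$ with generators $U_1,\dots,U_{n-1}$. An $(n,s)$-link pattern is the left half of a link diagram with exactly $s$ crossing links, the $s$ broken links being called defects; formal linear combinations of them are $(n,s)$-link states. Tangles act on link states by concatenation, a loop giving the factor $\nu$ and a path joining two defects (a turn-back path) giving the factor $0$. The bilinear form $(\cdot\,|\,\cdot)$ on $(n,s)$-link states is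 the bilinear extension of $(\alpha|\beta)=\nu^{\#\text{loops}}$ or $0$, for link patterns $\alpha,\beta$, according to whether the network obtained by joining the reflection of $\alpha$ to $\beta$ has no turn-back path (a path with both ends on the same side) or has one. For $0\le t<\bar{\mathfrak{p}}(q)$ the Jones–Wenzl projector $P_{(t)}\in\mathsf{TL}_t(\nu)$ is the unique nonzero element with $P_{(t)}^2=P_{(t)}$ and $U_iP_{(t)}=P_{(t)}U_i=0$ for all $i$. Suppose $\max\varsigma<\bar{\mathfrak{p}}(q)$, and let $P_\varsigma\in\mathsf{TL}_n(\nu)$ be the tangle made of $P_{(s_1)},\dots,P_{(s_d)}$ placed below each other. Group $n$ nodes on a line into $d$ consecutive valenced nodes, the $i$-th one carrying $s_i$ link ends; a loop link is a link with both ends at the same valenced node. Let $\mathsf{TL}_\varsigma(\nu)$ be the space of $n$-tangles with the nodes on both lines grouped in this way, modulo the diagrams having a loop link, with product $T\,U:=$ the class of $T P_\varsigma U$ and with unit the class of $\mathbf{1}_{\mathsf{TL}_n}$. For an integer $s\ge0$ let the standard module $\mathsf{L}_\varsigma^{(s)}$ be the space of $(n,s)$-link states with the nodes grouped in this way, modulo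 the link patterns having a loop link, with the action $T\alpha:=$ the class of $TP_\varsigma\alpha$ and the bilinear form $(\alpha|\beta):=(P_\varsigma\alpha\,|\,P_\varsigma\beta)$ (computed with loop-link-free representatives). Put $$\operatorname{rad}\mathsf{L}_\varsigma^{(s)}:=\{\alpha\in\mathsf{L}_\varsigma^{(s)} : (\alpha|\beta)=0 \text{ for all } \beta\in\mathsf{L}_\varsigma^{(s)}\},\qquad \mathsf{Q}_\varsigma^{(s)}:=\mathsf{L}_\varsigma^{(s)}/\operatorname{rad}\mathsf{L}_\varsigma^{(s)}.$$ **Proposition.** Suppose $\max\varsigma<\bar{\mathfrak{p}}(q)$ and $\operatorname{rad}\mathsf{L}_\varsigma^{(s)}\neq\mathsf{L}_\varsigma^{(s)}$. Then $\mathsf{TL}_\varsigma(\nu)$ is an associative unital algebra, $\mathsf{L}_\varsigma^{(s)}$ is a $\mathsf{TL}_\varsigma(\nu)$-module, $\operatorname{rad}\mathsf{L}_\varsigma^{(s)}$ is a submodule of it, and the following hold: 1. The quotient module $\mathsf{Q}_\varsigma^{(s)}$ is simple, and $\operatorname{rad}\mathsf{L}_\varsigma^{(s)}$ is the unique maximal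 proper submodule of $\mathsf{L}_\varsigma^{(s)}$. 2. The module $\mathsf{L}_\varsigma^{(s)}$ is indecomposable, i.e. it is nonzero and not a direct sum of two nonzero submodules. -/

import Mathlib

noncomputable section

namespace ValencedTL

/-! ### Link diagrams -/

/-- Position of a node on the boundary of the strip between the two vertical lines: we run down the
left line (`n` nodes) and then up the right line (`m` nodes). -/
def pos {n m : ℕ} : Fin n ⊕ Fin m → ℕ
  | Sum.inl i => i
  | Sum.inr j => n + (Fin.rev j : ℕ)

/-- An `(n, m)`-link diagram: `n` nodes on the left line, `m` nodes on the right line, joined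
pairwise by non-crossing links in the strip between the lines. Up to homotopy it is the non-crossing
perfect matching `partner` of the nodes. -/
@[ext]
structure LinkDiagram (n m : ℕ) where
  partner : Fin n ⊕ Fin m → Fin n ⊕ Fin m
  invol : ∀ x, partner (partner x) = x
  noFix : ∀ x, partner x ≠ x
  planar : ∀ x y, ¬ (pos x < pos y ∧ pos y < pos (partner x) ∧ pos (partner x) < pos (partner y))

instance (n m : ℕ) : Fintype (LinkDiagram n m) :=
  Fintype.ofInjective LinkDiagram.partner (fun _ _ h => LinkDiagram.ext h)

/-- The unit link diagram with `n` horizontal links. -/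
def unitDiagram (n : ℕ) : LinkDiagram n n where
  partner := Sum.swap
  invol x := by simp
  noFix x := by rcases x with x | x <;> simp
  planar x y := by
    rcases x with x | x <;> rcases y with y | y <;> simp [pos, Fin.rev] <;> omega

/-- The partner function of the diagram `U_i`: the nodes `i, i + 1` (counted from `0`) are joined
on either side, all other links are horizontal. -/
def turnPartner {n : ℕ} (i : ℕ) (hi : i + 1 < n) : Fin n ⊕ Fin n → Fin n ⊕ Fin n
  | Sum.inl j => if (j : ℕ) = i then Sum.inl ⟨i + 1, hi⟩
      else if (j : ℕ) = i + 1 then Sum.inl ⟨i, by omega⟩ else Sum.inr j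
  | Sum.inr j => if (j : ℕ) = i then Sum.inr ⟨i + 1, hi⟩
      else if (j : ℕ) = i + 1 then Sum.inr ⟨i, by omega⟩ else Sum.inl j

/-- The generator `U_i` of the Temperley-Lieb algebra. -/
def turnDiagram {n : ℕ} (i : ℕ) (hi : i + 1 < n) : LinkDiagram n n where
  partner := turnPartner i hi
  invol x := by
    rcases x with ⟨x, hx⟩ | ⟨x, hx⟩ <;> simp only [turnPartner] <;> split_ifs <;>
      simp_all
  noFix x := by
    rcases x with ⟨x, hx⟩ | ⟨x, hx⟩ <;> simp only [turnPartner] <;> split_ifs <;>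
      simp [Fin.ext_iff] <;> omega
  planar x y := by
    rcases x with ⟨x, hx⟩ | ⟨x, hx⟩ <;> rcases y with ⟨y, hy⟩ | ⟨y, hy⟩ <;>
      simp only [turnPartner] <;> split_ifs <;> simp [pos, Fin.rev] <;> omega

/-- Reflection of a link diagram about a vertical axis. -/
def reflect {n m : ℕ} (D : LinkDiagram n m) : LinkDiagram m n where
  partner x := (D.partner x.swap).swap
  invol x := by simp [D.invol]
  noFix x h := D.noFix x.swap (by rw [← Sum.swap_swap (D.partner x.swap), h])
  planar x y := by
    have key : ∀ z : Fin m ⊕ Fin n, pos z.swap + pos z + 1 = n + m := by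
      rintro (z | z) <;> simp [pos, Fin.rev] <;> omega
    have h1 := D.planar (D.partner y.swap) (D.partner x.swap)
    simp only [D.invol] at h1
    have hx := key x
    have hy := key y
    have hx' := key (D.partner x.swap).swap
    have hy' := key (D.partner y.swap).swap
    rw [Sum.swap_swap] at hx' hy'
    omega

/-! ### Concatenation of link diagrams -/

/-- The elementary links in the concatenation of `T` (left) and `U` (right); the nodes are those on
the left, the middle and the right line. -/
def Linked {n m k : ℕ} (T : LinkDiagram n m) (U : LinkDiagram m k)
    (x y : Fin n ⊕ (Fin m ⊕ Fin k)) : Prop :=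
  (∃ a, x = Sum.map id Sum.inl a ∧ y = Sum.map id Sum.inl (T.partner a)) ∨
    (∃ b, x = Sum.inr b ∧ y = Sum.inr (U.partner b))

/-- Two nodes are equivalent if they lie in the same connected component of the concatenation. -/
def strand {n m k : ℕ} (T : LinkDiagram n m) (U : LinkDiagram m k) :
    Setoid (Fin n ⊕ (Fin m ⊕ Fin k)) :=
  Relation.EqvGen.setoid (Linked T U)

/-- The nodes on the two outer lines. -/
def outer {n m k : ℕ} : Fin n ⊕ Fin k → Fin n ⊕ (Fin m ⊕ Fin k) :=
  Sum.map id Sum.inr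

/-- The number of loops in the concatenation: the connected components that do not contain an outer
node. -/
def numLoops {n m k : ℕ} (T : LinkDiagram n m) (U : LinkDiagram m k) : ℕ :=
  Nat.card {c : Quotient (strand T U) // ∀ x : Fin n ⊕ Fin k, Quotient.mk _ (outer x) ≠ c}

/-- `D` is the link diagram obtained from the concatenation of `T` and `U` by removing the loops:
it joins two different outer nodes exactly if a path in the concatenation does. -/
def IsConcat {n m k : ℕ} (T : LinkDiagram n m) (U : LinkDiagram m k) (D : LinkDiagram n k) : Prop :=
  ∀ x y, D.partner x = y ↔ (x ≠ y ∧ (strand T U) (outer x) (outer y))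

/-- `(n, m)`-tangles: formal complex linear combinations of `(n, m)`-link diagrams. -/
abbrev Tangle (n m : ℕ) : Type := LinkDiagram n m →₀ ℂ

/-- Bilinear extension of a map given on pairs of basis vectors. -/
def bilinExt {α β M : Type} [AddCommGroup M] [Module ℂ M] (f : α → β → M) :
    (α →₀ ℂ) →ₗ[ℂ] (β →₀ ℂ) →ₗ[ℂ] M :=
  Finsupp.linearCombination ℂ (fun a => Finsupp.linearCombination ℂ (f a))

open Classical in
/-- The concatenation of two link diagrams, with every loop replaced by the factor `ν`. The sum has
exactly one term: the unique link diagram that the concatenation leaves behind. -/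
def concat (ν : ℂ) {n m k : ℕ} (T : LinkDiagram n m) (U : LinkDiagram m k) : Tangle n k :=
  ∑ D : LinkDiagram n k, if IsConcat T U D then Finsupp.single D (ν ^ numLoops T U) else 0

/-- The composition of tangles. For `n = m = k` it is the product of the Temperley-Lieb algebra
`TL_n(ν)`. -/
def comp (ν : ℂ) {n m k : ℕ} : Tangle n m →ₗ[ℂ] Tangle m k →ₗ[ℂ] Tangle n k :=
  bilinExt (concat ν)

/-! ### Link patterns, link states and their bilinear form -/

/-- `(n, s)`-link patterns: the left half of a link diagram with exactly `s` crossing links. The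
broken links, called defects, are recorded as links to the `s` points of the cutting line; so every
one of these points is joined to a left node. -/
abbrev LinkPattern (n s : ℕ) : Type :=
  {D : LinkDiagram n s // ∀ j : Fin s, ∃ i : Fin n, D.partner (Sum.inr j) = Sum.inl i}

/-- `(n, s)`-link states. -/
abbrev LinkState (n s : ℕ) : Type := LinkPattern n s →₀ ℂ

/-- A link state as a tangle. -/
def stateToTangle (n s : ℕ) : LinkState n s →ₗ[ℂ] Tangle n s :=
  Finsupp.lmapDomain ℂ ℂ Subtype.val

/-- Setting every diagram in which two defects are joined (a turn-back path) to zero. -/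
def dropTurnBacks (n s : ℕ) : Tangle n s →ₗ[ℂ] LinkState n s :=
  Finsupp.lsubtypeDomain
    {D : LinkDiagram n s | ∀ j : Fin s, ∃ i : Fin n, D.partner (Sum.inr j) = Sum.inl i}

/-- Concatenation of a tangle to a link state: loops give the factor `ν` and turn-back paths the
factor zero. -/
def linkAct (ν : ℂ) (n m s : ℕ) : Tangle n m →ₗ[ℂ] LinkState m s →ₗ[ℂ] LinkState n s :=
  ((comp ν).compl₂ (stateToTangle m s)).compr₂ (dropTurnBacks n s)

/-- The network of `α` reflected and joined to `β` has a turn-back path, that is, a path with two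
different ends on the same side. -/
def HasTurnBack {n s : ℕ} (α β : LinkPattern n s) : Prop :=
  ∃ i j : Fin s, i ≠ j ∧
    ((strand (reflect α.1) β.1) (outer (Sum.inl i)) (outer (Sum.inl j)) ∨
      (strand (reflect α.1) β.1) (outer (Sum.inr i)) (outer (Sum.inr j)))

open Classical in
/-- The evaluation of the network of two link patterns: loops have weight `ν`, through-paths weight
one and turn-back paths weight zero. -/
def network (ν : ℂ) {n s : ℕ} (α β : LinkPattern n s) : ℂ :=
  if HasTurnBack α β then 0 else ν ^ numLoops (reflect α.1) β.1

/-- The link state bilinear form on `(n, s)`-link states. -/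
def form (ν : ℂ) (n s : ℕ) : LinkState n s →ₗ[ℂ] LinkState n s →ₗ[ℂ] ℂ :=
  bilinExt (network ν)

/-! ### Jones-Wenzl projectors -/

/-- The properties that determine the Jones-Wenzl projector of size `s`. -/
def IsJonesWenzl (ν : ℂ) {s : ℕ} (P : Tangle s s) : Prop :=
  P ≠ 0 ∧ comp ν P P = P ∧
    ∀ (i : ℕ) (hi : i + 1 < s), comp ν (Finsupp.single (turnDiagram i hi) 1) P = 0 ∧
      comp ν P (Finsupp.single (turnDiagram i hi) 1) = 0

open Classical in
/-- The Jones-Wenzl projector of size `s` (zero if there is none). -/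
def jonesWenzl (ν : ℂ) (s : ℕ) : Tangle s s :=
  if h : ∃ P : Tangle s s, IsJonesWenzl ν P then h.choose else 0

/-! ### Valenced nodes

A multiindex is a function `ς : Fin d → ℕ`. The `n = ∑ i, ς i` link ends at its nodes are numbered
from the top: first those at node `0`, then those at node `1`, and so on. -/

/-- The node at which a link end sits. -/
def node {d : ℕ} (ς : Fin d → ℕ) (x : Fin (∑ i, ς i)) : Fin d := (finSigmaFinEquiv.symm x).1

/-- The number of link ends at the nodes above node `i`. -/
def offset {d : ℕ} (ς : Fin d → ℕ) (i : Fin d) : ℕ := ∑ k with k < i, ς k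

lemma val_end {d : ℕ} (ς : Fin d → ℕ) (i : Fin d) (a : Fin (ς i)) :
    ((finSigmaFinEquiv ⟨i, a⟩ : Fin (∑ i, ς i)) : ℕ) = offset ς i + a := by
  rw [finSigmaFinEquiv_apply, offset]
  congr 1
  refine Finset.sum_bij (fun k _ => Fin.castLE i.2.le k) ?_ ?_ ?_ ?_
  · intro k _
    simpa using Fin.lt_def.2 k.2
  · intro k _ l _ h
    simpa [Fin.ext_iff] using h
  · intro k hk
    simp only [Finset.mem_filter, Finset.mem_univ, true_and] at hk
    exact ⟨⟨k, hk⟩, Finset.mem_univ _, rfl⟩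
  · intro k _
    rfl

lemma offset_add_le {d : ℕ} (ς : Fin d → ℕ) (i : Fin d) : offset ς i + ς i ≤ ∑ k, ς k := by
  rw [offset, add_comm, ← Finset.sum_insert (by simp)]
  exact Finset.sum_le_sum_of_subset (Finset.subset_univ _)

lemma offset_le {d : ℕ} (ς : Fin d → ℕ) {i j : Fin d} (h : i < j) :
    offset ς i + ς i ≤ offset ς j := by
  rw [offset, add_comm, ← Finset.sum_insert (by simp), offset]
  refine Finset.sum_le_sum_of_subset fun k hk => ?_
  simp only [Finset.mem_insert, Finset.mem_filter, Finset.mem_univ, true_and] at hk ⊢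
  rcases hk with rfl | hk
  exacts [h, hk.trans h]

/-- The ends of `d` diagrams, as the ends of the diagram in which they are stacked. -/
def stackEquiv {d : ℕ} (ς : Fin d → ℕ) :
    (Σ i : Fin d, (Fin (ς i) ⊕ Fin (ς i))) ≃ Fin (∑ i, ς i) ⊕ Fin (∑ i, ς i) :=
  (Equiv.sigmaSumDistrib _ _).trans (Equiv.sumCongr finSigmaFinEquiv finSigmaFinEquiv)

lemma pos_stackEquiv {d : ℕ} (ς : Fin d → ℕ) (i : Fin d) (u : Fin (ς i) ⊕ Fin (ς i)) :
    (pos u < ς i ∧ pos (stackEquiv ς ⟨i, u⟩) = offset ς i + pos u) ∨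
      (ς i ≤ pos u ∧ pos u < 2 * ς i ∧
        pos (stackEquiv ς ⟨i, u⟩) + offset ς i + 2 * ς i = 2 * (∑ k, ς k) + pos u) := by
  have h := offset_add_le ς i
  rcases u with u | u
  · left
    have h1 : pos (stackEquiv ς ⟨i, Sum.inl u⟩) =
        ((finSigmaFinEquiv ⟨i, u⟩ : Fin (∑ i, ς i)) : ℕ) := rfl
    rw [h1, val_end]
    exact ⟨u.2, rfl⟩
  · right
    have h1 : pos (stackEquiv ς ⟨i, Sum.inr u⟩) = (∑ k, ς k) +
        (Fin.rev (finSigmaFinEquiv ⟨i, u⟩ : Fin (∑ i, ς i)) : ℕ) := rfl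
    rw [h1, Fin.val_rev, val_end]
    simp only [pos, Fin.val_rev]
    omega

/-- The partner function of `d` link diagrams side by side. -/
def stackPartner {d : ℕ} {ς : Fin d → ℕ} (D : ∀ i, LinkDiagram (ς i) (ς i))
    (z : Σ i : Fin d, (Fin (ς i) ⊕ Fin (ς i))) : Σ i : Fin d, (Fin (ς i) ⊕ Fin (ς i)) :=
  ⟨z.1, (D z.1).partner z.2⟩

/-- The link diagram obtained by placing `d` link diagrams below each other. -/
def stack {d : ℕ} {ς : Fin d → ℕ} (D : ∀ i, LinkDiagram (ς i) (ς i)) :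
    LinkDiagram (∑ i, ς i) (∑ i, ς i) where
  partner x := stackEquiv ς (stackPartner D ((stackEquiv ς).symm x))
  invol x := by
    obtain ⟨⟨i, u⟩, rfl⟩ := (stackEquiv ς).surjective x
    rw [Equiv.symm_apply_apply, Equiv.symm_apply_apply]
    simp only [stackPartner, LinkDiagram.invol]
  noFix x := by
    obtain ⟨⟨i, u⟩, rfl⟩ := (stackEquiv ς).surjective x
    rw [Equiv.symm_apply_apply, Ne, EmbeddingLike.apply_eq_iff_eq]
    simpa only [stackPartner, Sigma.mk.injEq, heq_eq_eq, true_and] using (D i).noFix u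
  planar x y := by
    obtain ⟨⟨i, u⟩, rfl⟩ := (stackEquiv ς).surjective x
    obtain ⟨⟨j, v⟩, rfl⟩ := (stackEquiv ς).surjective y
    rw [Equiv.symm_apply_apply, Equiv.symm_apply_apply]
    simp only [stackPartner]
    have hi := offset_add_le ς i
    have hj := offset_add_le ς j
    have h1 := pos_stackEquiv ς i u
    have h2 := pos_stackEquiv ς j v
    have h3 := pos_stackEquiv ς i ((D i).partner u)
    have h4 := pos_stackEquiv ς j ((D j).partner v)
    rcases lt_trichotomy i j with hij | rfl | hij
    · have := offset_le ς hij
      omega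
    · have := (D i).planar u v
      omega
    · have := offset_le ς hij
      omega

/-- The Jones-Wenzl composite projector: projector boxes of the sizes `ς i` placed below each
other, each box being decomposed into link diagrams. -/
def compositeProjector (ν : ℂ) {d : ℕ} (ς : Fin d → ℕ) : Tangle (∑ i, ς i) (∑ i, ς i) :=
  ∑ D : (∀ i, LinkDiagram (ς i) (ς i)),
    Finsupp.single (stack D) (∏ i, jonesWenzl ν (ς i) (D i))

/-- The diagram has a loop link at one of the left nodes, grouped according to `ς`. -/
def HasLeftLoopLink {d : ℕ} (ς : Fin d → ℕ) {m : ℕ} (D : LinkDiagram (∑ i, ς i) m) : Prop :=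
  ∃ x y, D.partner (Sum.inl x) = Sum.inl y ∧ node ς x = node ς y

/-- The diagram has a loop link at one of the right nodes, grouped according to `ϖ`. -/
def HasRightLoopLink {d : ℕ} (ϖ : Fin d → ℕ) {n : ℕ} (D : LinkDiagram n (∑ i, ϖ i)) : Prop :=
  ∃ x y, D.partner (Sum.inr x) = Sum.inr y ∧ node ϖ x = node ϖ y

/-! ### The valenced Temperley-Lieb algebra -/

/-- `ς`-valenced link diagrams without loop links. -/
abbrev ValencedDiagram {d : ℕ} (ς : Fin d → ℕ) : Type :=
  {D : LinkDiagram (∑ i, ς i) (∑ i, ς i) // ¬ HasLeftLoopLink ς D ∧ ¬ HasRightLoopLink ς D}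

/-- The space `TL_ς` of `ς`-valenced tangles, modulo the diagrams with loop links. -/
abbrev ValencedTangle {d : ℕ} (ς : Fin d → ℕ) : Type := ValencedDiagram ς →₀ ℂ

/-- Separating the link ends at each node. -/
def openTangle {d : ℕ} (ς : Fin d → ℕ) :
    ValencedTangle ς →ₗ[ℂ] Tangle (∑ i, ς i) (∑ i, ς i) :=
  Finsupp.lmapDomain ℂ ℂ Subtype.val

/-- Collecting the link ends at the nodes, and setting diagrams with loop links to zero. -/
def closeTangle {d : ℕ} (ς : Fin d → ℕ) :
    Tangle (∑ i, ς i) (∑ i, ς i) →ₗ[ℂ] ValencedTangle ς :=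
  Finsupp.lsubtypeDomain {D | ¬ HasLeftLoopLink ς D ∧ ¬ HasRightLoopLink ς D}

/-- The product of `TL_ς(ν)`: concatenate, replace the nodes in the middle by projector boxes,
decompose them, replace loops by `ν` and diagrams with loop links by zero. -/
def mul (ν : ℂ) {d : ℕ} (ς : Fin d → ℕ) :
    ValencedTangle ς →ₗ[ℂ] ValencedTangle ς →ₗ[ℂ] ValencedTangle ς :=
  ((comp ν).compl₁₂ (openTangle ς)
    (comp ν (compositeProjector ν ς) ∘ₗ openTangle ς)).compr₂ (closeTangle ς)

/-- The unit of `TL_ς(ν)`. -/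
def one {d : ℕ} (ς : Fin d → ℕ) : ValencedTangle ς :=
  Finsupp.single ⟨unitDiagram _, by
    constructor <;> rintro ⟨x, y, h, -⟩ <;> simp [unitDiagram] at h⟩ 1

/-! ### Standard modules -/

/-- `(ς, s)`-valenced link patterns without loop links. -/
abbrev ValencedPattern {d : ℕ} (ς : Fin d → ℕ) (s : ℕ) : Type :=
  {α : LinkPattern (∑ i, ς i) s // ¬ HasLeftLoopLink ς α.1}

/-- The space `L_ς^(s)` of `(ς, s)`-valenced link states, modulo the patterns with loop links. -/
abbrev ValencedState {d : ℕ} (ς : Fin d → ℕ) (s : ℕ) : Type := ValencedPattern ς s →₀ ℂ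

/-- Separating the link ends at each node. -/
def openState {d : ℕ} (ς : Fin d → ℕ) (s : ℕ) : ValencedState ς s →ₗ[ℂ] LinkState (∑ i, ς i) s :=
  Finsupp.lmapDomain ℂ ℂ Subtype.val

/-- Collecting the link ends at the nodes, and setting patterns with loop links to zero. -/
def closeState {d : ℕ} (ς : Fin d → ℕ) (s : ℕ) :
    LinkState (∑ i, ς i) s →ₗ[ℂ] ValencedState ς s :=
  Finsupp.lsubtypeDomain {α : LinkPattern (∑ i, ς i) s | ¬ HasLeftLoopLink ς α.1}

/-- The map `I_ς` from `(ς, s)`-valenced link states to `(n, s)`-link states: every node is replaced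
by a projector box. -/
def embed (ν : ℂ) {d : ℕ} (ς : Fin d → ℕ) (s : ℕ) :
    ValencedState ς s →ₗ[ℂ] LinkState (∑ i, ς i) s :=
  linkAct ν _ _ s (compositeProjector ν ς) ∘ₗ openState ς s

/-- The action of `TL_ς(ν)` on the standard module `L_ς^(s)`: concatenate, replace the nodes in the
middle by projector boxes, decompose them, replace loops by `ν`, turn-back paths by zero and diagrams
with loop links by zero. -/
def act (ν : ℂ) {d : ℕ} (ς : Fin d → ℕ) (s : ℕ) :
    ValencedTangle ς →ₗ[ℂ] Module.End ℂ (ValencedState ς s) :=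
  ((linkAct ν _ _ s).compl₁₂ (openTangle ς) (embed ν ς s)).compr₂ (closeState ς s)

/-- The valenced link state bilinear form `(α | β) = (I_ς α | I_ς β)`. -/
def valencedForm (ν : ℂ) {d : ℕ} (ς : Fin d → ℕ) (s : ℕ) :
    ValencedState ς s →ₗ[ℂ] ValencedState ς s →ₗ[ℂ] ℂ :=
  (form ν _ s).compl₁₂ (embed ν ς s) (embed ν ς s)

/-- The radical of `L_ς^(s)`: all `α` with `(α | β) = 0` for all `β` in `L_ς^(s)`. -/
def radical (ν : ℂ) {d : ℕ} (ς : Fin d → ℕ) (s : ℕ) : Submodule ℂ (ValencedState ς s) :=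
  LinearMap.ker (valencedForm ν ς s)

/-! ### Modules over an algebra given by its product -/

section Modules

variable {A V : Type} [AddCommGroup A] [Module ℂ A] [AddCommGroup V] [Module ℂ V]

/-- `A` is an associative unital algebra with the given product and unit, and `ρ` makes `V` an
`A`-module. -/
structure IsModuleOver (mul : A →ₗ[ℂ] A →ₗ[ℂ] A) (one : A) (ρ : A →ₗ[ℂ] Module.End ℂ V) :
    Prop where
  mul_assoc : ∀ a b c, mul (mul a b) c = mul a (mul b c)
  one_mul : ∀ a, mul one a = a
  mul_one : ∀ a, mul a one = a
  act_mul : ∀ a b v, ρ (mul a b) v = ρ a (ρ b v)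
  act_one : ∀ v, ρ one v = v

/-- `W` is an `A`-submodule of `V`. -/
def IsSubmodule (ρ : A →ₗ[ℂ] Module.End ℂ V) (W : Submodule ℂ V) : Prop :=
  ∀ a, ∀ v ∈ W, ρ a v ∈ W

/-- The action of `A` on the quotient of `V` by a submodule. -/
def quotientAct (ρ : A →ₗ[ℂ] Module.End ℂ V) (W : Submodule ℂ V) (hW : IsSubmodule ρ W) :
    A →ₗ[ℂ] Module.End ℂ (V ⧸ W) where
  toFun a := W.mapQ W (ρ a) (hW a)
  map_add' a b := by ext v; simp
  map_smul' c a := by ext v; simp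

/-- The module is simple: it is nonzero and has no submodules except zero and itself. -/
def IsSimple (ρ : A →ₗ[ℂ] Module.End ℂ V) : Prop :=
  Nontrivial V ∧ ∀ W, IsSubmodule ρ W → W = ⊥ ∨ W = ⊤

/-- The module is indecomposable: it is nonzero and not the direct sum of two nonzero submodules. -/
def IsIndecomposable (ρ : A →ₗ[ℂ] Module.End ℂ V) : Prop :=
  Nontrivial V ∧ ∀ U W, IsSubmodule ρ U → IsSubmodule ρ W → IsCompl U W → U = ⊥ ∨ W = ⊥

/-- `W` is maximal among the proper submodules of `V`. -/
def IsMaximalProper (ρ : A →ₗ[ℂ] Module.End ℂ V) (W : Submodule ℂ V) : Prop :=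
  IsSubmodule ρ W ∧ W ≠ ⊤ ∧ ∀ W', IsSubmodule ρ W' → W ≤ W' → W' ≠ ⊤ → W' = W

end Modules

/-! ### Parameters -/

/-- The fugacity `ν = -q - q⁻¹`. -/
def fugacity (q : ℂ) : ℂ := -q - q⁻¹

/-- `p` if `q = exp (π i p' / p)` with coprime positive integers `p, p'` (which determines `p`), and
infinity if there are no such integers, that is, if `q` is not a root of unity. -/
def minPower (q : ℂ) : ℕ∞ :=
  sInf {x : ℕ∞ | ∃ p p' : ℕ, 0 < p ∧ 0 < p' ∧ Nat.Coprime p p' ∧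
    q = Complex.exp (Real.pi * Complex.I * p' / p) ∧ x = p}

open Classical in
/-- The modification of `minPower` that is infinite at `q = 1` and `q = -1`. -/
def minPowerBar (q : ℂ) : ℕ∞ := if q = 1 ∨ q = -1 then ⊤ else minPower q

end ValencedTL

end

noncomputable section

namespace ValencedTL

/-! ### Contraction of non-crossing matchings -/

/-! The core is a rank-one argument. Write `P` for the composite projector and `v†` for the
reflection of a link state `v`. The tangle `u v†` acts on the standard module by `w ↦ (v | w) u`
(`act_stateTangle_flip`): in `v† P w`, a tangle on `s` strands, every diagram except the unit
contains a turn-back path, and the coefficient of the unit is the form. So a submodule containing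
some `w` outside the radical contains every `u`; in other words, every proper submodule lies in the
radical (`le_radical`). The radical is itself a submodule, since the form is symmetric and the
adjoint of a tangle is its reflection (`isSubmodule_radical`). Simplicity, unique maximality and
indecomposability follow by lattice arguments.

Most of the work goes into the algebra of tangles. A link diagram is encoded by the zero-one matrix
of the two-colourings of its nodes that are constant on links. A product of two such matrices is `2
^ l` times the matrix of another diagram (`exists_colorMatrix_mul`), where `l` counts the loops,
each of which may take either colour (`numLoops_of_colorMatrix`). The matrix determines both the
diagram and the exponent (`colorMatrix_smul_inj`), so associativity of matrix multiplication, which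
is the case of loop weight 2, transfers to every `ν` (`comp_assoc`).

The Jones-Wenzl projectors come from the Wenzl recursion (`wenzl_spec`), whose denominators are
quantum integers that do not vanish in the admissible range. By planarity a non-unit diagram has a
link between neighbours on each side, so a projector annihilates it; this makes the projector
unique, invariant under reflection and of unit coefficient one. Stacking acts blockwise, so `P` is
an idempotent fixed by reflection that kills loop links.

Quotients by loop links are modelled by loop-link-free representatives. Discarding diagrams is
invisible to a linear map that kills them (`map_lmapDomain_lsubtypeDomain`): a loop link next to `P`
is annihilated, and one on an outer line survives every concatenation until it is discarded at the
end. -/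

/-- `f` restricts to a non-crossing perfect matching of the set `S`, whose points are placed on a
line by `p`. -/
structure IsNoncrossing {X : Type*} (p : X → ℕ) (S : Set X) (f : X → X) : Prop where
  maps : ∀ x ∈ S, f x ∈ S
  invol : ∀ x ∈ S, f (f x) = x
  noFix : ∀ x ∈ S, f x ≠ x
  planar : ∀ x ∈ S, ∀ y ∈ S, ¬ (p x < p y ∧ p y < p (f x) ∧ p (f x) < p (f y))

/-- The matching that is left when the neighbours `a` and `b` are glued to each other. -/
def contract {X : Type*} [DecidableEq X] (f : X → X) (a b : X) (x : X) : X :=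
  if f x = a then f b else if f x = b then f a else f x

/-- `z` lies strictly between `u` and `v`. -/
def Between (u v z : ℕ) : Prop := (u < z ∧ z < v) ∨ (v < z ∧ z < u)

/-- Parity of crossings: a walk from `x` to `a`, then to `b`, then to `v` passes `z` an odd number
of times exactly when `z` separates `x` from `v`, and the step from `a` to `b` never passes `z`. -/
lemma between_glue {x v a b z : ℕ} (hab : a < b)
    (hz : z < a ∨ b < z) (hzx : z ≠ x) (hzv : z ≠ v) :
    Between x v z ↔ ¬ (Between x a z ↔ Between b v z) := by
  simp only [Between]
  omega

/-- The planarity axiom excludes a single order pattern. Applying it to both orientations of both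
links, in either role, gives the symmetric form: a link does not separate the ends of another one.
-/
lemma IsNoncrossing.between_iff {X : Type*} {p : X → ℕ} (hp : Function.Injective p)
    {S : Set X} {f : X → X} (h : IsNoncrossing p S f) {x y : X} (hx : x ∈ S) (hy : y ∈ S)
    (h1 : y ≠ x) (h2 : y ≠ f x) :
    Between (p x) (p (f x)) (p y) ↔ Between (p x) (p (f x)) (p (f y)) := by
  have ne : ∀ z w, z ≠ w → p z ≠ p w := fun z w hzw e => hzw (hp e)
  have n1 := ne _ _ h1
  have n2 := ne _ _ h2
  have n3 := ne (f y) x fun e => h2 (by rw [← e, h.invol y hy])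
  have n4 := ne (f y) (f x) fun e => h1 (by rw [← h.invol y hy, e, h.invol x hx])
  have cross : ∀ x ∈ S, ∀ y ∈ S, ¬ (p x < p y ∧ p y < p (f x) ∧ p (f x) < p (f y)) ∧
      ¬ (p x < p (f y) ∧ p (f y) < p (f x) ∧ p (f x) < p y) ∧
      ¬ (p (f x) < p y ∧ p y < p x ∧ p x < p (f y)) ∧
      ¬ (p (f x) < p (f y) ∧ p (f y) < p x ∧ p x < p y) := by
    intro x hx y hy
    refine ⟨h.planar x hx y hy, ?_, ?_, ?_⟩
    · simpa only [h.invol y hy] using h.planar x hx _ (h.maps y hy)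
    · simpa only [h.invol x hx] using h.planar _ (h.maps x hx) y hy
    · simpa only [h.invol x hx, h.invol y hy] using h.planar _ (h.maps x hx) _ (h.maps y hy)
  have c1 := cross x hx y hy
  have c2 := cross y hy x hx
  clear cross ne
  simp only [Between]
  constructor <;> rintro (h3 | h3) <;> by_contra h4 <;> omega

/-- A glued link is a link ending at `a` followed by one starting at `b`. Neither separates the ends
of a third link, and no point of `S` lies between `a` and `b`, so by `between_glue` the glued link
does not separate them either. -/
lemma IsNoncrossing.contract {X : Type*} [DecidableEq X] {p : X → ℕ} (hp : Function.Injective p)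
    {S : Set X} {f : X → X} (h : IsNoncrossing p S f) {a b : X} (ha : a ∈ S) (hb : b ∈ S)
    (hab : p a < p b) (hadj : ∀ x ∈ S, p x ≤ p a ∨ p b ≤ p x) :
    IsNoncrossing p {x | x ∈ S ∧ x ≠ a ∧ x ≠ b} (contract f a b) := by
  have hne : a ≠ b := fun e => by simp [e] at hab
  have maps := h.maps
  have invol := h.invol
  have noFix := h.noFix
  refine ⟨?_, ?_, ?_, ?_⟩
  · rintro x ⟨hx, hxa, hxb⟩
    simp only [ValencedTL.contract, Set.mem_ofPred_eq]
    grind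
  · rintro x ⟨hx, hxa, hxb⟩
    simp only [ValencedTL.contract]
    grind
  · rintro x ⟨hx, hxa, hxb⟩
    simp only [ValencedTL.contract]
    grind
  · rintro x ⟨hx, hxa, hxb⟩ y ⟨hy, hya, hyb⟩
    have ne : ∀ z w, z ≠ w → p z ≠ p w := fun z w hzw e => hzw (hp e)
    have adj : ∀ x ∈ S, x ≠ a → x ≠ b → p x < p a ∨ p b < p x := fun x hx h1 h2 => by
      have := hadj x hx
      have := ne x a h1
      have := ne x b h2
      omega
    have inj : ∀ z w, z ∈ S → w ∈ S → f z = f w → z = w := fun z w hz hw e => by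
      rw [← invol z hz, e, invol w hw]
    have btw : ∀ x ∈ S, ∀ y ∈ S, y ≠ x → y ≠ f x →
        (Between (p x) (p (f x)) (p y) ↔ Between (p x) (p (f x)) (p (f y))) :=
      fun x hx y hy => h.between_iff hp hx hy
    have glue : ∀ x y, x ∈ S → y ∈ S → y ≠ a → y ≠ b → f x = a → f y ≠ a →
        f y ≠ b → y ≠ x → y ≠ f b →
        (Between (p x) (p (f b)) (p y) ↔ Between (p x) (p (f b)) (p (f y))) := by
      intro x y hx hy hya hyb e1 e2 e3 hyx hyv
      have i2 := adj y hy hya hyb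
      have i3 := adj (f y) (maps y hy) e2 e3
      have b1 := btw x hx y hy hyx (e1 ▸ hya)
      have b2 := btw b hb y hy hyb hyv
      have n1 := ne _ _ hyx
      have n2 := ne _ _ hyv
      have n3 := ne (f y) x fun e => hya (by rw [← invol y hy, e, e1])
      have n4 := ne (f y) (f b) fun e => hyb (inj _ _ hy hb e)
      rw [e1] at b1
      rw [between_glue hab i2 n1 n2, between_glue hab i3 n3 n4, b1, b2]
    simp only [ValencedTL.contract]
    rintro ⟨h1, h2, h3⟩
    have ffa : f (f a) = a := invol a ha
    have ne' : ∀ z w : X, z ∈ S → w ∈ S → f z ≠ w → z ≠ f w := fun z w hz hw hzw e =>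
      hzw (by rw [e, invol w hw])
    by_cases e1 : f x = a
    · have e2 : f y ≠ a := fun e => by rw [inj x y hx hy (e1.trans e.symm)] at h1; omega
      rw [if_pos e1] at h2 h3
      rw [if_neg e2] at h3
      by_cases e3 : f y = b
      · rw [← e3, invol y hy] at h2; omega
      · rw [if_neg e3] at h3
        have := glue x y hx hy hya hyb e1 e2 e3 (fun e => by rw [e] at h1; omega)
          (ne' _ _ hy hb e3)
        simp only [Between] at this
        omega
    · rw [if_neg e1] at h2 h3
      by_cases e2 : f x = b
      · have fb : f b = x := by rw [← e2, invol x hx]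
        have e3 : f y ≠ b := fun e => by rw [inj x y hx hy (e2.trans e.symm)] at h1; omega
        rw [if_pos e2] at h2 h3
        by_cases e4 : f y = a
        · rw [← e4, invol y hy] at h2; omega
        · rw [if_neg e4, if_neg e3] at h3
          have := glue (f a) y (maps a ha) hy hya hyb ffa e4 e3 (ne' _ _ hy ha e4)
            (ne' _ _ hy hb e3)
          simp only [Between, fb] at this
          omega
      · rw [if_neg e2] at h2 h3
        by_cases e3 : f y = a
        · rw [if_pos e3] at h3
          have := glue y x hy hx hxa hxb e3 e1 e2 (fun e => by rw [e] at h1; omega)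
            (ne' _ _ hx hb e2)
          simp only [Between] at this
          omega
        · rw [if_neg e3] at h3
          by_cases e4 : f y = b
          · have fb : f b = y := by rw [← e4, invol y hy]
            rw [if_pos e4] at h3
            have := glue (f a) x (maps a ha) hx hxa hxb ffa e1 e2 (ne' _ _ hx ha e1)
              (ne' _ _ hx hb e2)
            simp only [Between, fb] at this
            omega
          · rw [if_neg e4] at h3
            exact h.planar x hx y hy ⟨h1, h2, h3⟩

-- The glued points share one colour `c`. If they are joined to each other, gluing closes a loop and
-- both values of `c` are allowed; otherwise `c` is forced to be the colour at the other end of the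
-- link at `a`, and the two links at `a` and `b` merge.
open Classical in
lemma IsNoncrossing.sum_contract {X : Type*} [DecidableEq X] {p : X → ℕ}
    {S : Set X} {f : X → X} (h : IsNoncrossing p S f) {a b : X} (ha : a ∈ S) (hb : b ∈ S)
    (hne : a ≠ b) : ∃ l : ℕ, ∀ g : X → Bool,
      (∑ c : Bool, if ∀ x ∈ S, Function.update (Function.update g a c) b c (f x) =
        Function.update (Function.update g a c) b c x then 1 else 0) =
      if ∀ x ∈ {x | x ∈ S ∧ x ≠ a ∧ x ≠ b}, g (ValencedTL.contract f a b x) = g x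
        then 2 ^ l else 0 := by
  have maps := h.maps
  have invol := h.invol
  have noFix := h.noFix
  by_cases hfa : f a = b
  · refine ⟨1, fun g => ?_⟩
    have key : ∀ c, (∀ x ∈ S, Function.update (Function.update g a c) b c (f x) =
        Function.update (Function.update g a c) b c x) ↔
        ∀ x ∈ {x | x ∈ S ∧ x ≠ a ∧ x ≠ b}, g (ValencedTL.contract f a b x) = g x := by
      intro c
      simp only [ValencedTL.contract, Function.update_apply, Set.mem_ofPred_eq]
      grind
    simp only [key]
    simp
  · refine ⟨0, fun g => ?_⟩
    have key : ∀ c, (∀ x ∈ S, Function.update (Function.update g a c) b c (f x) =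
        Function.update (Function.update g a c) b c x) ↔ c = g (f a) ∧
        ∀ x ∈ {x | x ∈ S ∧ x ≠ a ∧ x ≠ b}, g (ValencedTL.contract f a b x) = g x := by
      intro c
      simp only [ValencedTL.contract, Function.update_apply, Set.mem_ofPred_eq]
      constructor
      · intro hc
        have h1 := hc a ha
        have h2 := hc b hb
        refine ⟨by grind, fun x hx => ?_⟩
        have h3 := hc x hx.1
        grind
      · rintro ⟨rfl, hc⟩ x hx
        have h2 := hc (f a)
        have h3 := hc (f b)
        have h4 := hc x
        grind
    simp only [key, ite_and]
    simp

/-! ### Colourings of link diagrams -/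

/-- The colouring of the nodes by `a` and `b` is constant on the links. -/
def IsColoring {n m : ℕ} (D : LinkDiagram n m) (a : Fin n → Bool) (b : Fin m → Bool) : Prop :=
  ∀ x, Sum.elim a b (D.partner x) = Sum.elim a b x

open Classical in
/-- The zero-one matrix of the two-colourings of a link diagram. -/
def colorMatrix {n m : ℕ} (D : LinkDiagram n m) : Matrix (Fin n → Bool) (Fin m → Bool) ℕ :=
  Matrix.of fun a b => if IsColoring D a b then 1 else 0

/-- The nodes of two diagrams drawn side by side, the middle line being doubled. -/
abbrev DoubleNode (n m k : ℕ) : Type := (Fin n ⊕ Fin m) ⊕ (Fin m ⊕ Fin k)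

/-- The position of a node on the boundary of two diagrams drawn side by side. -/
def doublePos {n m k : ℕ} : DoubleNode n m k → ℕ
  | Sum.inl x => pos x
  | Sum.inr y => n + m + pos y

lemma pos_lt {n m : ℕ} (x : Fin n ⊕ Fin m) : pos x < n + m := by
  rcases x with x | x <;> simp only [pos, Fin.val_rev] <;> omega

lemma pos_injective {n m : ℕ} : Function.Injective (pos : Fin n ⊕ Fin m → ℕ) := by
  rintro (x | x) (y | y) h <;> simp [pos, Fin.rev, Fin.ext_iff] at h ⊢ <;> omega

lemma doublePos_injective {n m k : ℕ} :
    Function.Injective (doublePos : DoubleNode n m k → ℕ) := by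
  rintro (x | x) (y | y) h
  · exact congrArg _ (pos_injective h)
  · have := pos_lt x; simp only [doublePos] at h; omega
  · have := pos_lt y; simp only [doublePos] at h; omega
  · simp only [doublePos, Nat.add_left_cancel_iff] at h
    exact congrArg _ (pos_injective h)

/-- The nodes that are left when the first `j` nodes of the doubled middle line are removed. -/
def restNodes (n m k j : ℕ) : Set (DoubleNode n m k) :=
  {x | ∀ i : Fin m, (x = Sum.inl (Sum.inr i) ∨ x = Sum.inr (Sum.inl i)) → j ≤ i}

/-- Recolouring the first `j` nodes of the doubled middle line. -/
def recolor {n m k j : ℕ} (g : DoubleNode n m k → Bool) (b : Fin j → Bool) :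
    DoubleNode n m k → Bool
  | Sum.inl (Sum.inl x) => g (Sum.inl (Sum.inl x))
  | Sum.inl (Sum.inr i) => if h : (i : ℕ) < j then b ⟨i, h⟩ else g (Sum.inl (Sum.inr i))
  | Sum.inr (Sum.inl i) => if h : (i : ℕ) < j then b ⟨i, h⟩ else g (Sum.inr (Sum.inl i))
  | Sum.inr (Sum.inr x) => g (Sum.inr (Sum.inr x))

lemma recolor_snoc {n m k j : ℕ} (hj : j < m) (g : DoubleNode n m k → Bool) (b : Fin j → Bool)
    (c : Bool) : recolor g (Fin.snoc b c : Fin (j + 1) → Bool) =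
      recolor (Function.update (Function.update g (Sum.inl (Sum.inr ⟨j, hj⟩)) c)
        (Sum.inr (Sum.inl ⟨j, hj⟩)) c) b := by
  funext x
  rcases x with (x | x) | (x | x) <;> simp only [recolor, Fin.snoc, Function.update_apply]
  · simp
  · rcases lt_trichotomy (x : ℕ) j with h | h | h
    · have : x ≠ ⟨j, hj⟩ := by rintro rfl; simp at h
      simp [h, h.trans (Nat.lt_succ_self j)]
    · have : x = ⟨j, hj⟩ := Fin.ext h
      simp [this]
    · have : x ≠ ⟨j, hj⟩ := by rintro rfl; simp at h
      have h1 : ¬ (x : ℕ) < j := by omega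
      have h2 : ¬ (x : ℕ) < j + 1 := by omega
      simp [h1, h2, this]
  · rcases lt_trichotomy (x : ℕ) j with h | h | h
    · have : x ≠ ⟨j, hj⟩ := by rintro rfl; simp at h
      simp [h, h.trans (Nat.lt_succ_self j)]
    · have : x = ⟨j, hj⟩ := Fin.ext h
      simp [this]
    · have : x ≠ ⟨j, hj⟩ := by rintro rfl; simp at h
      have h1 : ¬ (x : ℕ) < j := by omega
      have h2 : ¬ (x : ℕ) < j + 1 := by omega
      simp [h1, h2, this]
  · simp

lemma isNoncrossing_map {n m k : ℕ} (T : LinkDiagram n m) (U : LinkDiagram m k) :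
    IsNoncrossing doublePos (restNodes n m k 0) (Sum.map T.partner U.partner) := by
  refine ⟨fun x _ i _ => Nat.zero_le _, ?_, ?_, ?_⟩
  · rintro (x | x) - <;> simp [T.invol, U.invol]
  · rintro (x | x) - <;> simp [T.noFix, U.noFix]
  · rintro (x | x) - (y | y) - <;> simp only [Sum.map_inl, Sum.map_inr, doublePos]
    · exact T.planar x y
    · have := pos_lt (T.partner x); omega
    · have := pos_lt y; omega
    · have := U.planar x y; omega

-- The middle line is glued to its copy one node at a time, starting from node `0`, and each gluing
-- is a contraction. The exponent `l` accumulates the loops closed on the way.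
open Classical in
lemma exists_contraction {n m k : ℕ} (T : LinkDiagram n m) (U : LinkDiagram m k) (j : ℕ)
    (hj : j ≤ m) : ∃ (f : DoubleNode n m k → DoubleNode n m k) (l : ℕ),
      IsNoncrossing doublePos (restNodes n m k j) f ∧ ∀ g : DoubleNode n m k → Bool,
        (∑ b : Fin j → Bool, if ∀ x, recolor g b (Sum.map T.partner U.partner x) = recolor g b x
          then 1 else 0) = if ∀ x ∈ restNodes n m k j, g (f x) = g x then 2 ^ l else 0 := by
  induction j with
  | zero =>
    refine ⟨_, 0, isNoncrossing_map T U, fun g => ?_⟩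
    have h0 : ∀ b : Fin 0 → Bool, recolor g b = g := by
      intro b; funext x
      rcases x with (x | x) | (x | x) <;> simp [recolor]
    simp [h0, restNodes]
  | succ j ih =>
    obtain ⟨f, l, hf, hl⟩ := ih (by omega)
    have hjm : j < m := hj
    have ha : (Sum.inl (Sum.inr ⟨j, hjm⟩) : DoubleNode n m k) ∈ restNodes n m k j := by
      rintro i (h | h)
      · simp only [Sum.inl.injEq, Sum.inr.injEq] at h
        simp [← h]
      · simp at h
    have hb : (Sum.inr (Sum.inl ⟨j, hjm⟩) : DoubleNode n m k) ∈ restNodes n m k j := by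
      rintro i (h | h)
      · simp at h
      · simp only [Sum.inl.injEq, Sum.inr.injEq] at h
        simp [← h]
    have hS : {x | x ∈ restNodes n m k j ∧ x ≠ Sum.inl (Sum.inr ⟨j, hjm⟩) ∧
        x ≠ Sum.inr (Sum.inl ⟨j, hjm⟩)} = restNodes n m k (j + 1) := by
      ext x
      constructor
      · rintro ⟨h1, h2, h3⟩ i hi
        have h4 := h1 i hi
        have h5 : (i : ℕ) ≠ j := by
          rintro rfl
          rcases hi with hi | hi
          exacts [h2 hi, h3 hi]
        omega
      · intro h
        refine ⟨fun i hi => (Nat.le_succ j).trans (h i hi), ?_, ?_⟩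
        · intro e
          have := h _ (Or.inl e)
          simp at this
        · intro e
          have := h _ (Or.inr e)
          simp at this
    obtain ⟨l', hl'⟩ := hf.sum_contract ha hb (by simp)
    -- The two copies of node `j` sit at positions `n + m - 1 - j` and `n + m + j`. Everything
    -- between them belongs to copies of earlier nodes, which are already removed, so they are
    -- neighbours.
    have hc := hf.contract doublePos_injective ha hb (by
        have h1 := pos_lt (Sum.inr ⟨j, hjm⟩ : Fin n ⊕ Fin m)
        simp only [doublePos]; omega) (by
        intro x hx
        rcases x with (x | x) | (x | x)
        · left; simp [doublePos, pos]; omega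
        · have := hx x (Or.inl rfl)
          left; simp [doublePos, pos, Fin.rev]; omega
        · have := hx x (Or.inr rfl)
          right; simp [doublePos, pos]; omega
        · right; simp [doublePos, pos]; omega)
    rw [hS] at hc hl'
    refine ⟨_, l + l', hc, fun g => ?_⟩
    rw [← (Fin.snocEquiv (fun _ : Fin (j + 1) => Bool)).sum_comp, Fintype.sum_prod_type]
    have h1 := hl' g
    have h2 : ∀ c : Bool, (∑ b : Fin j → Bool, if ∀ x,
        recolor g (Fin.snoc b c : Fin (j + 1) → Bool) (Sum.map T.partner U.partner x) =
          recolor g (Fin.snoc b c : Fin (j + 1) → Bool) x then 1 else 0) =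
        2 ^ l * if ∀ x ∈ restNodes n m k j,
          Function.update (Function.update g (Sum.inl (Sum.inr ⟨j, hjm⟩)) c)
            (Sum.inr (Sum.inl ⟨j, hjm⟩)) c (f x) =
          Function.update (Function.update g (Sum.inl (Sum.inr ⟨j, hjm⟩)) c)
            (Sum.inr (Sum.inl ⟨j, hjm⟩)) c x then 1 else 0 := by
      intro c
      rw [mul_ite, mul_one, mul_zero, ← hl]
      refine Finset.sum_congr rfl fun b _ => ?_
      rw [recolor_snoc hjm]
    refine (Finset.sum_congr rfl fun c _ => h2 c).trans ?_
    rw [← Finset.mul_sum]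
    refine (congrArg (2 ^ l * ·) (Eq.trans ?_ h1)).trans ?_
    · exact Finset.sum_congr rfl fun c _ => by congr
    · simp only [mul_ite, mul_zero, pow_add]

/-- An entry of the product counts the colourings of the middle line that fit both diagrams. Once
all middle nodes are glued, the remaining non-crossing matching of the outer nodes is the diagram
sought, so its planarity comes from the contractions. -/
lemma exists_colorMatrix_mul {n m k : ℕ} (T : LinkDiagram n m) (U : LinkDiagram m k) :
    ∃ (D : LinkDiagram n k) (l : ℕ), colorMatrix T * colorMatrix U = 2 ^ l • colorMatrix D := by
  classical
  obtain ⟨f, l, hf, hl⟩ := exists_contraction T U m le_rfl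
  let e : Fin n ⊕ Fin k → DoubleNode n m k := Sum.map Sum.inl Sum.inr
  have mem : ∀ x, e x ∈ restNodes n m k m := by
    rintro (x | x) i (h | h) <;> simp [e] at h
  have hsurj : ∀ y ∈ restNodes n m k m, ∃ x, e x = y := by
    rintro ((y | y) | (y | y)) hy
    · exact ⟨Sum.inl y, rfl⟩
    · have := hy y (Or.inl rfl); omega
    · have := hy y (Or.inr rfl); omega
    · exact ⟨Sum.inr y, rfl⟩
  have hinj : Function.Injective e := Sum.map_injective.2 ⟨Sum.inl_injective, Sum.inr_injective⟩
  have hpos : ∀ x y, doublePos (e x) < doublePos (e y) ↔ pos x < pos y := by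
    rintro (x | x) (y | y) <;> simp [e, doublePos, pos, Fin.rev] <;> omega
  choose g hg using fun x => hsurj _ (hf.maps _ (mem x))
  refine ⟨⟨g, fun x => hinj ?_, fun x h => hf.noFix _ (mem x) ?_, fun x y h => ?_⟩, l, ?_⟩
  · rw [hg, hg, hf.invol _ (mem x)]
  · rw [← hg, h]
  · refine hf.planar _ (mem x) _ (mem y) ?_
    rw [← hg, ← hg, hpos, hpos, hpos]
    exact h
  · ext a c
    have h := hl (Sum.elim (Sum.elim a fun _ => false) (Sum.elim (fun _ => false) c))
    have h1 : ∀ b : Fin m → Bool, (recolor (Sum.elim (Sum.elim a fun _ => false)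
        (Sum.elim (fun _ => false) c)) b : DoubleNode n m k → Bool) =
        Sum.elim (Sum.elim a b) (Sum.elim b c) := by
      intro b
      funext x
      rcases x with (x | x) | (x | x) <;> simp [recolor]
    simp only [h1] at h
    simp only [Matrix.mul_apply, colorMatrix, Matrix.of_apply, Matrix.smul_apply, smul_eq_mul,
      mul_ite, mul_one, mul_zero, ← ite_and]
    refine Eq.trans (Finset.sum_congr rfl fun b _ => if_congr ?_ rfl rfl)
      (h.trans (if_congr ?_ rfl rfl))
    · rw [Sum.forall, and_comm]
      have h2 : ∀ x, Sum.elim (Sum.elim a b) (Sum.elim b c) (Sum.inr x) = Sum.elim b c x :=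
        fun _ => rfl
      simp only [Sum.map_inl, Sum.map_inr, Sum.elim_inl, h2, IsColoring]
    · have h2 : ∀ x, Sum.elim (Sum.elim a fun _ => false) (Sum.elim (fun _ => false) c) (e x) =
          Sum.elim a c x := by
        rintro (x | x) <;> rfl
      constructor
      · intro h3 x
        rw [← h2, ← h2]
        exact (congrArg _ (hg x)).trans (h3 _ (mem x))
      · intro h3 x hx
        obtain ⟨x, rfl⟩ := hsurj x hx
        rw [← hg, h2, h2]
        exact h3 x

/-! ### Concatenation in terms of colourings -/

lemma isColoring_const {n m : ℕ} (D : LinkDiagram n m) (c : Bool) :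
    IsColoring D (fun _ => c) (fun _ => c) := by
  have h : ∀ x : Fin n ⊕ Fin m, Sum.elim (fun _ => c) (fun _ => c) x = c := by
    rintro (x | x) <;> rfl
  intro x
  rw [h, h]

/-- Colour exactly the link of `D` at `x`: the partner of `x` in `E` has the same colour, so it is
the other end of that link. One implication between colourings therefore suffices. -/
lemma ext_of_isColoring {n m : ℕ} {D E : LinkDiagram n m}
    (h : ∀ a b, IsColoring D a b → IsColoring E a b) : D = E := by
  ext1
  funext x
  classical
  let g : Fin n ⊕ Fin m → Bool := fun y => decide (y = x ∨ y = D.partner x)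
  have hg : ∀ y, Sum.elim (g ∘ Sum.inl) (g ∘ Sum.inr) y = g y := by rintro (y | y) <;> rfl
  have h1 : IsColoring D (g ∘ Sum.inl) (g ∘ Sum.inr) := by
    intro y
    rw [hg, hg]
    simp only [g, decide_eq_decide]
    constructor
    · rintro (e | e)
      · right; rw [← e, D.invol]
      · left; rw [← D.invol y, e, D.invol]
    · rintro (e | e)
      · right; rw [e]
      · left; rw [e, D.invol]
  have h2 := h _ _ h1 x
  rw [hg, hg] at h2
  have h3 : g x = true := by simp [g]
  rw [h3] at h2
  rcases of_decide_eq_true h2 with h4 | h4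
  · exact absurd h4 (E.noFix x)
  · exact h4.symm

lemma colorMatrix_apply_ne_zero {n m : ℕ} {D : LinkDiagram n m} {a : Fin n → Bool}
    {b : Fin m → Bool} : colorMatrix D a b ≠ 0 ↔ IsColoring D a b := by
  simp [colorMatrix]

lemma colorMatrix_const {n m : ℕ} (D : LinkDiagram n m) (c : Bool) :
    colorMatrix D (fun _ => c) (fun _ => c) = 1 := by
  simp [colorMatrix, isColoring_const]

/-- Every diagram admits the constant colouring, whose entry is one; this entry reveals the
exponent, and the support of the matrix reveals the diagram. -/
lemma colorMatrix_smul_inj {n m l k : ℕ} {D E : LinkDiagram n m}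
    (h : 2 ^ l • colorMatrix D = 2 ^ k • colorMatrix E) : l = k ∧ D = E := by
  have h1 := congrFun (congrFun h fun _ => false) fun _ => false
  simp only [Matrix.smul_apply, colorMatrix_const, smul_eq_mul, mul_one] at h1
  refine ⟨Nat.pow_right_injective le_rfl h1, ext_of_isColoring fun a b hab => ?_⟩
  have h2 := congrFun (congrFun h a) b
  rw [← colorMatrix_apply_ne_zero] at hab ⊢
  intro h3
  simp [h3, hab] at h2

lemma forall_linked_iff {n m k : ℕ} (T : LinkDiagram n m) (U : LinkDiagram m k)
    (a : Fin n → Bool) (b : Fin m → Bool) (c : Fin k → Bool) :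
    (∀ x y, Linked T U x y → Sum.elim a (Sum.elim b c) x = Sum.elim a (Sum.elim b c) y) ↔
      IsColoring T a b ∧ IsColoring U b c := by
  have h1 : ∀ x, Sum.elim a (Sum.elim b c) (Sum.map id Sum.inl x) = Sum.elim a b x := by
    rintro (x | x) <;> rfl
  constructor
  · intro h
    refine ⟨fun x => ?_, fun x => ?_⟩
    · rw [← h1, ← h1]
      exact (h _ _ (Or.inl ⟨x, rfl, rfl⟩)).symm
    · exact (h _ _ (Or.inr ⟨x, rfl, rfl⟩)).symm
  · rintro ⟨hT, hU⟩ x y (⟨z, rfl, rfl⟩ | ⟨z, rfl, rfl⟩)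
    · rw [h1, h1]
      exact (hT z).symm
    · exact (hU z).symm

lemma eq_of_strand {n m k : ℕ} {T : LinkDiagram n m} {U : LinkDiagram m k}
    {g : Fin n ⊕ (Fin m ⊕ Fin k) → Bool} (hg : ∀ x y, Linked T U x y → g x = g y)
    {x y : Fin n ⊕ (Fin m ⊕ Fin k)} (h : strand T U x y) : g x = g y := by
  induction h with
  | rel x y h => exact hg x y h
  | refl x => rfl
  | symm x y _ ih => exact ih.symm
  | trans x y z _ _ h1 h2 => exact h1.trans h2

lemma elim_comp {α β γ δ : Type*} (g : α ⊕ (β ⊕ γ) → δ) :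
    Sum.elim (g ∘ Sum.inl) (Sum.elim (g ∘ Sum.inr ∘ Sum.inl) (g ∘ Sum.inr ∘ Sum.inr)) = g := by
  funext x
  rcases x with x | x | x <;> rfl

/-- Two-colourings separate connected components: for the converse, take the indicator function of
the component of `x`. -/
lemma strand_iff {n m k : ℕ} (T : LinkDiagram n m) (U : LinkDiagram m k)
    (x y : Fin n ⊕ (Fin m ⊕ Fin k)) : strand T U x y ↔ ∀ a b c, IsColoring T a b →
      IsColoring U b c → Sum.elim a (Sum.elim b c) x = Sum.elim a (Sum.elim b c) y := by
  constructor
  · intro h a b c hT hU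
    exact eq_of_strand ((forall_linked_iff T U a b c).2 ⟨hT, hU⟩) h
  · intro h
    classical
    let g : Fin n ⊕ (Fin m ⊕ Fin k) → Bool := fun z => decide (strand T U x z)
    have hg : ∀ u v, Linked T U u v → g u = g v := by
      intro u v huv
      have : strand T U u v := Relation.EqvGen.rel _ _ huv
      simp only [g, decide_eq_decide]
      exact ⟨fun h => Setoid.trans' _ h this, fun h => Setoid.trans' _ h (Setoid.symm' _ this)⟩
    have h1 := (forall_linked_iff T U (g ∘ Sum.inl) (g ∘ Sum.inr ∘ Sum.inl)
      (g ∘ Sum.inr ∘ Sum.inr)).1 (by rw [elim_comp]; exact hg)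
    have h2 := h _ _ _ h1.1 h1.2
    rw [elim_comp] at h2
    exact of_decide_eq_true (h2.symm.trans (decide_eq_true (Setoid.refl' _ x)))

/-- Equality of supports says that the colourings of `D` are exactly the outer restrictions of
colourings of the whole network. So `D` and the network identify the same outer nodes. -/
lemma isConcat_of_colorMatrix {n m k l : ℕ} {T : LinkDiagram n m} {U : LinkDiagram m k}
    {D : LinkDiagram n k} (h : colorMatrix T * colorMatrix U = 2 ^ l • colorMatrix D) :
    IsConcat T U D := by
  have h1 : ∀ a c, IsColoring D a c ↔ ∃ b, IsColoring T a b ∧ IsColoring U b c := by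
    intro a c
    have h2 := congrFun (congrFun h a) c
    rw [← colorMatrix_apply_ne_zero, ← not_iff_not, not_not]
    have h3 : colorMatrix D a c = 0 ↔ (colorMatrix T * colorMatrix U) a c = 0 := by
      rw [h2]
      simp
    rw [h3, Matrix.mul_apply, Finset.sum_eq_zero_iff]
    simp only [Finset.mem_univ, forall_const, mul_eq_zero, not_exists, not_and_or,
      ← colorMatrix_apply_ne_zero, not_not]
  have h2 : ∀ x y, (strand T U) (outer x) (outer y) ↔
      ∀ a c, IsColoring D a c → Sum.elim a c x = Sum.elim a c y := by
    have h3 : ∀ (a : Fin n → Bool) (b : Fin m → Bool) (c : Fin k → Bool) x,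
        Sum.elim a (Sum.elim b c) (outer x) = Sum.elim a c x := by
      rintro a b c (x | x) <;> rfl
    intro x y
    rw [strand_iff]
    simp only [h3, h1]
    exact ⟨fun h a c ⟨b, hT, hU⟩ => h a b c hT hU, fun h a b c hT hU => h a c ⟨b, hT, hU⟩⟩
  intro x y
  rw [h2]
  constructor
  · rintro rfl
    exact ⟨(D.noFix x).symm, fun a c h => (h x).symm⟩
  · rintro ⟨hxy, h3⟩
    classical
    let g : Fin n ⊕ Fin k → Bool := fun z => decide (z = x ∨ z = D.partner x)
    have hg : ∀ y, Sum.elim (g ∘ Sum.inl) (g ∘ Sum.inr) y = g y := by rintro (y | y) <;> rfl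
    have h4 := h3 (g ∘ Sum.inl) (g ∘ Sum.inr) (by
      intro z
      rw [hg, hg]
      simp only [g, decide_eq_decide]
      constructor
      · rintro (e | e)
        · right; rw [← e, D.invol]
        · left; rw [← D.invol z, e, D.invol]
      · rintro (e | e)
        · right; rw [e]
        · left; rw [e, D.invol])
    rw [hg, hg] at h4
    have h5 := of_decide_eq_true (h4.symm.trans (decide_eq_true (Or.inl rfl)))
    rcases h5 with h5 | h5
    · exact absurd h5.symm hxy
    · exact h5.symm

lemma IsConcat.unique {n m k : ℕ} {T : LinkDiagram n m} {U : LinkDiagram m k}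
    {D E : LinkDiagram n k} (hD : IsConcat T U D) (hE : IsConcat T U E) : D = E := by
  ext1
  funext x
  exact (hD x _).2 ((hE x _).1 rfl)

/-- With every outer node coloured `false`, the matrix entry `2 ^ l` counts the colourings of the
middle line that vanish on strands reaching an outer node and are arbitrary on each loop. -/
lemma numLoops_of_colorMatrix {n m k l : ℕ} {T : LinkDiagram n m} {U : LinkDiagram m k}
    {D : LinkDiagram n k} (h : colorMatrix T * colorMatrix U = 2 ^ l • colorMatrix D) :
    numLoops T U = l := by
  classical
  have h0 := congrFun (congrFun h fun _ => false) fun _ => false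
  simp only [Matrix.smul_apply, colorMatrix_const, smul_eq_mul, mul_one, Matrix.mul_apply] at h0
  simp only [colorMatrix, Matrix.of_apply, mul_ite, mul_one, mul_zero, ← ite_and] at h0
  rw [← Finset.card_filter, ← Fintype.card_subtype] at h0
  have : Finite (Quotient (strand T U)) := Quotient.finite _
  set L := {c : Quotient (strand T U) // ∀ x : Fin n ⊕ Fin k, Quotient.mk _ (outer x) ≠ c} with hL
  -- A choice of colours for the loops, extended by `false` to all other components.
  let F : (L → Bool) → Fin n ⊕ (Fin m ⊕ Fin k) → Bool := fun φ z =>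
    if hz : ∀ x : Fin n ⊕ Fin k, Quotient.mk (strand T U) (outer x) ≠ Quotient.mk _ z
      then φ ⟨_, hz⟩ else false
  have hF : ∀ φ u v, Linked T U u v → F φ u = F φ v := by
    intro φ u v huv
    have : Quotient.mk (strand T U) u = Quotient.mk _ v :=
      Quotient.sound (Relation.EqvGen.rel _ _ huv)
    simp only [F, this]
  have hF1 : ∀ φ, F φ = Sum.elim (fun _ => false) (Sum.elim (F φ ∘ Sum.inr ∘ Sum.inl)
      fun _ => false) := by
    intro φ
    funext z
    rcases z with z | z | z
    · exact dif_neg fun h => h (Sum.inl z) rfl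
    · rfl
    · exact dif_neg fun h => h (Sum.inr z) rfl
  have key : Nat.card (L → Bool) = 2 ^ l := by
    rw [← h0, ← Nat.card_eq_fintype_card]
    refine Nat.card_eq_of_bijective (fun φ => ⟨F φ ∘ Sum.inr ∘ Sum.inl, ?_⟩) ⟨?_, ?_⟩
    · have := (forall_linked_iff T U (fun _ => false) (F φ ∘ Sum.inr ∘ Sum.inl)
        (fun _ => false)).1 (by rw [← hF1]; exact hF φ)
      exact this.symm
    · intro φ ψ hφ
      have h1 : F φ = F ψ := by rw [hF1 φ, hF1 ψ, Subtype.mk.inj hφ]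
      funext ⟨c, hc⟩
      induction c using Quotient.inductionOn with
      | h z =>
        have := congrFun h1 z
        simpa only [F, dif_pos hc] using this
    · rintro ⟨b, hb⟩
      set g : Fin n ⊕ (Fin m ⊕ Fin k) → Bool :=
        Sum.elim (fun _ => false) (Sum.elim b fun _ => false) with hg
      have hgl := (forall_linked_iff T U _ _ _).2 hb.symm
      rw [← hg] at hgl
      refine ⟨fun c => Quotient.lift g (fun u v huv => eq_of_strand hgl huv) c.1, ?_⟩
      refine Subtype.ext (funext fun j => ?_)
      show F (fun c => Quotient.lift g (fun u v huv => eq_of_strand hgl huv) c.1)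
        (Sum.inr (Sum.inl j)) = b j
      simp only [F]
      split_ifs with hz
      · rfl
      · push Not at hz
        obtain ⟨x, hx⟩ := hz
        have h1 : g (outer x) = g (Sum.inr (Sum.inl j)) := eq_of_strand hgl (Quotient.exact hx)
        have h2 : g (outer x) = false := by rcases x with x | x <;> rfl
        exact h2.symm.trans h1
  rw [Nat.card_fun, Nat.card_eq_fintype_card, Fintype.card_bool] at key
  exact Nat.pow_right_injective le_rfl key

lemma concat_eq {n m k l : ℕ} {T : LinkDiagram n m} {U : LinkDiagram m k}
    {D : LinkDiagram n k} (h : colorMatrix T * colorMatrix U = 2 ^ l • colorMatrix D) (ν : ℂ) :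
    concat ν T U = Finsupp.single D (ν ^ l) := by
  have hD := isConcat_of_colorMatrix h
  rw [concat, Finset.sum_eq_single D]
  · rw [if_pos hD, numLoops_of_colorMatrix h]
  · intro E _ hE
    exact if_neg fun h => hE (h.unique hD)
  · simp

lemma comp_single_single (ν : ℂ) {n m k : ℕ} (T : LinkDiagram n m) (U : LinkDiagram m k)
    (x y : ℂ) : comp ν (Finsupp.single T x) (Finsupp.single U y) = (x * y) • concat ν T U := by
  simp [comp, bilinExt, mul_smul]

lemma comp_single_eq {n m k l : ℕ} {T : LinkDiagram n m} {U : LinkDiagram m k}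
    {D : LinkDiagram n k} (h : colorMatrix T * colorMatrix U = 2 ^ l • colorMatrix D) (ν x y : ℂ) :
    comp ν (Finsupp.single T x) (Finsupp.single U y) = Finsupp.single D (x * y * ν ^ l) := by
  rw [comp_single_single, concat_eq h, Finsupp.smul_single, smul_eq_mul]

/-- On diagrams, both bracketings give a power of `ν` times one diagram. Matrix associativity
identifies the two diagrams and the total numbers of loops, which do not depend on `ν`. -/
lemma comp_assoc (ν : ℂ) {n m k r : ℕ} (x : Tangle n m) (y : Tangle m k) (z : Tangle k r) :
    comp ν (comp ν x y) z = comp ν x (comp ν y z) := by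
  induction x using Finsupp.induction_linear with
  | zero => simp
  | add f g hf hg => simp only [map_add, LinearMap.add_apply, hf, hg]
  | single T x =>
  induction y using Finsupp.induction_linear with
  | zero => simp
  | add f g hf hg => simp only [map_add, LinearMap.add_apply, hf, hg]
  | single U y =>
  induction z using Finsupp.induction_linear with
  | zero => simp
  | add f g hf hg => simp only [map_add, hf, hg]
  | single V z =>
  obtain ⟨D, l, hD⟩ := exists_colorMatrix_mul T U
  obtain ⟨E, i, hE⟩ := exists_colorMatrix_mul U V
  obtain ⟨F, j, hF⟩ := exists_colorMatrix_mul D V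
  obtain ⟨G, k, hG⟩ := exists_colorMatrix_mul T E
  have h : 2 ^ (l + j) • colorMatrix F = 2 ^ (i + k) • colorMatrix G := by
    rw [pow_add, pow_add, mul_smul, mul_smul, ← hF, ← hG, ← Matrix.smul_mul, ← hD,
      ← Matrix.mul_smul, ← hE, Matrix.mul_assoc]
  obtain ⟨h1, rfl⟩ := colorMatrix_smul_inj h
  rw [comp_single_eq hD, comp_single_eq hE, comp_single_eq hF, comp_single_eq hG]
  congr 1
  calc x * y * ν ^ l * z * ν ^ j = x * y * z * ν ^ (l + j) := by ring
    _ = x * (y * z * ν ^ i) * ν ^ k := by rw [h1]; ring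

/-! ### The unit -/

lemma isColoring_unitDiagram {n : ℕ} (a b : Fin n → Bool) :
    IsColoring (unitDiagram n) a b ↔ a = b := by
  simp only [IsColoring, unitDiagram, Sum.forall, Sum.swap_inl, Sum.swap_inr, Sum.elim_inl,
    Sum.elim_inr, funext_iff]
  exact ⟨fun h => h.2, fun h => ⟨fun i => (h i).symm, h⟩⟩

lemma colorMatrix_unitDiagram (n : ℕ) : colorMatrix (unitDiagram n) = 1 := by
  ext a b
  simp [colorMatrix, isColoring_unitDiagram, Matrix.one_apply]

/-- The unit of the Temperley-Lieb algebra. -/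
def unitTangle (n : ℕ) : Tangle n n := Finsupp.single (unitDiagram n) 1

lemma unitTangle_comp (ν : ℂ) {n m : ℕ} (x : Tangle n m) : comp ν (unitTangle n) x = x := by
  induction x using Finsupp.induction_linear with
  | zero => simp
  | add f g hf hg => simp only [map_add, hf, hg]
  | single T x =>
    rw [unitTangle, comp_single_eq (D := T) (l := 0) (by simp [colorMatrix_unitDiagram])]
    simp

lemma comp_unitTangle (ν : ℂ) {n m : ℕ} (x : Tangle n m) : comp ν x (unitTangle m) = x := by
  induction x using Finsupp.induction_linear with
  | zero => simp
  | add f g hf hg => simp only [map_add, LinearMap.add_apply, hf, hg]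
  | single T x =>
    rw [unitTangle, comp_single_eq (D := T) (l := 0) (by simp [colorMatrix_unitDiagram])]
    simp

/-! ### Reflection -/

lemma isColoring_reflect {n m : ℕ} (D : LinkDiagram n m) (a : Fin m → Bool) (b : Fin n → Bool) :
    IsColoring (reflect D) a b ↔ IsColoring D b a := by
  have h : ∀ x : Fin n ⊕ Fin m, Sum.elim a b x.swap = Sum.elim b a x := by
    rintro (x | x) <;> rfl
  constructor
  · intro h1 x
    have := h1 x.swap
    simpa only [reflect, Sum.swap_swap, h] using this
  · intro h1 x
    have := h1 x.swap
    rw [← h, ← h, Sum.swap_swap] at this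
    exact this

lemma colorMatrix_reflect {n m : ℕ} (D : LinkDiagram n m) :
    colorMatrix (reflect D) = (colorMatrix D).transpose := by
  ext a b
  classical exact if_congr (isColoring_reflect D a b) rfl rfl

lemma reflect_reflect {n m : ℕ} (D : LinkDiagram n m) : reflect (reflect D) = D := by
  ext1
  funext x
  simp [reflect]

lemma reflect_unitDiagram (n : ℕ) : reflect (unitDiagram n) = unitDiagram n := by
  ext1
  funext x
  simp [reflect, unitDiagram]

/-- The linear extension of the reflection. -/
def flip {n m : ℕ} : Tangle n m →ₗ[ℂ] Tangle m n := Finsupp.lmapDomain ℂ ℂ reflect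

lemma flip_single {n m : ℕ} (D : LinkDiagram n m) (x : ℂ) :
    flip (Finsupp.single D x) = Finsupp.single (reflect D) x := by
  simp [flip]

lemma flip_flip {n m : ℕ} (x : Tangle n m) : flip (flip x) = x := by
  induction x using Finsupp.induction_linear with
  | zero => simp
  | add f g hf hg => simp only [map_add, hf, hg]
  | single T x => rw [flip_single, flip_single, reflect_reflect]

lemma flip_unitTangle (n : ℕ) : flip (unitTangle n) = unitTangle n := by
  rw [unitTangle, flip_single, reflect_unitDiagram]

lemma flip_comp (ν : ℂ) {n m k : ℕ} (x : Tangle n m) (y : Tangle m k) :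
    flip (comp ν x y) = comp ν (flip y) (flip x) := by
  induction x using Finsupp.induction_linear with
  | zero => simp
  | add f g hf hg => simp only [map_add, LinearMap.add_apply, hf, hg]
  | single T x =>
  induction y using Finsupp.induction_linear with
  | zero => simp
  | add f g hf hg => simp only [map_add, LinearMap.add_apply, hf, hg]
  | single U y =>
  obtain ⟨D, l, hD⟩ := exists_colorMatrix_mul T U
  rw [comp_single_eq hD, flip_single, flip_single, flip_single,
    comp_single_eq (D := reflect D) (l := l), mul_comm x y]
  rw [colorMatrix_reflect, colorMatrix_reflect, colorMatrix_reflect, ← Matrix.transpose_mul, hD,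
    Matrix.transpose_smul]

/-! ### Links that survive concatenation -/

lemma concat_left_link {n m k l : ℕ} {T : LinkDiagram n m} {U : LinkDiagram m k}
    {D : LinkDiagram n k} (h : colorMatrix T * colorMatrix U = 2 ^ l • colorMatrix D) {x y : Fin n}
    (hxy : T.partner (Sum.inl x) = Sum.inl y) : D.partner (Sum.inl x) = Sum.inl y := by
  refine (isConcat_of_colorMatrix h _ _).2
    ⟨fun e => T.noFix (Sum.inl x) (hxy.trans (congrArg _ (Sum.inl.inj e).symm)), ?_⟩
  exact Relation.EqvGen.rel _ _ (Or.inl ⟨Sum.inl x, rfl, by rw [hxy]; rfl⟩)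

lemma concat_right_link {n m k l : ℕ} {T : LinkDiagram n m} {U : LinkDiagram m k}
    {D : LinkDiagram n k} (h : colorMatrix T * colorMatrix U = 2 ^ l • colorMatrix D) {x y : Fin k}
    (hxy : U.partner (Sum.inr x) = Sum.inr y) : D.partner (Sum.inr x) = Sum.inr y := by
  refine (isConcat_of_colorMatrix h _ _).2
    ⟨fun e => U.noFix (Sum.inr x) (hxy.trans (congrArg _ (Sum.inr.inj e).symm)), ?_⟩
  exact Relation.EqvGen.rel _ _ (Or.inr ⟨Sum.inr x, rfl, by rw [hxy]; rfl⟩)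

/-! ### The generators of the Temperley-Lieb algebra -/

/-- Recolouring the nodes `i` and `i + 1`. -/
def recolorPair {n : ℕ} (a : Fin n → Bool) (i : ℕ) (t : Bool) : Fin n → Bool :=
  fun j => if (j : ℕ) = i ∨ (j : ℕ) = i + 1 then t else a j

lemma isColoring_turnDiagram {n i : ℕ} (hi : i + 1 < n) (a b : Fin n → Bool) :
    IsColoring (turnDiagram i hi) a b ↔ a ⟨i, by omega⟩ = a ⟨i + 1, hi⟩ ∧
      b ⟨i, by omega⟩ = b ⟨i + 1, hi⟩ ∧ ∀ j : Fin n, (j : ℕ) ≠ i → (j : ℕ) ≠ i + 1 → a j = b j := by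
  simp only [IsColoring, turnDiagram, Sum.forall, turnPartner, Sum.elim_inl, Sum.elim_inr]
  constructor
  · rintro ⟨h1, h2⟩
    have h3 := h1 ⟨i, by omega⟩
    have h4 := h2 ⟨i, by omega⟩
    simp only [if_true, Sum.elim_inl, Sum.elim_inr] at h3 h4
    refine ⟨h3.symm, h4.symm, fun j hj hj' => ?_⟩
    have h5 := h2 j
    rwa [if_neg hj, if_neg hj'] at h5
  · rintro ⟨h1, h2, h3⟩
    constructor
    · intro j
      by_cases hj : (j : ℕ) = i
      · rw [show j = ⟨i, by omega⟩ from Fin.ext hj]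
        simp [h1]
      · by_cases hj' : (j : ℕ) = i + 1
        · rw [show j = ⟨i + 1, hi⟩ from Fin.ext hj']
          simp [h1]
        · simp [hj, hj', h3 j hj hj']
    · intro j
      by_cases hj : (j : ℕ) = i
      · rw [show j = ⟨i, by omega⟩ from Fin.ext hj]
        simp [h2]
      · by_cases hj' : (j : ℕ) = i + 1
        · rw [show j = ⟨i + 1, hi⟩ from Fin.ext hj']
          simp [h2]
        · simp [hj, hj', h3 j hj hj']

/-- Left multiplication by a generator tests whether two neighbouring colours agree and then sums
over a new common colour. The Temperley-Lieb relations become computations with this operator. -/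
lemma colorMatrix_turnDiagram_mul {n i : ℕ} {κ : Type*} (hi : i + 1 < n)
    (A : Matrix (Fin n → Bool) κ ℕ) (a : Fin n → Bool) (c : κ) :
    (colorMatrix (turnDiagram i hi) * A) a c =
      if a ⟨i, by omega⟩ = a ⟨i + 1, hi⟩ then ∑ t, A (recolorPair a i t) c else 0 := by
  classical
  have h : ∀ b, colorMatrix (turnDiagram i hi) a b =
      if a ⟨i, by omega⟩ = a ⟨i + 1, hi⟩ then ∑ t, if b = recolorPair a i t then 1 else 0 else 0 := by
    intro b
    have h1 : ∀ t, b = recolorPair a i t ↔ t = b ⟨i, by omega⟩ ∧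
        b ⟨i, by omega⟩ = b ⟨i + 1, hi⟩ ∧
          ∀ j : Fin n, (j : ℕ) ≠ i → (j : ℕ) ≠ i + 1 → a j = b j := by
      intro t
      constructor
      · intro hb
        rw [hb]
        refine ⟨by simp [recolorPair], by simp [recolorPair], fun j h1 h2 => ?_⟩
        simp [recolorPair, h1, h2]
      · rintro ⟨rfl, h2, h3⟩
        funext j
        simp only [recolorPair]
        split_ifs with hj
        · rcases hj with hj | hj
          · exact congrArg b (Fin.ext hj)
          · rw [h2]
            exact congrArg b (Fin.ext hj)
        · push Not at hj
          exact (h3 j hj.1 hj.2).symm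
    simp only [h1, ite_and, Finset.sum_ite_eq', Finset.mem_univ, if_true]
    simp only [← ite_and, colorMatrix, Matrix.of_apply, isColoring_turnDiagram]
  simp only [Matrix.mul_apply, h, ite_mul, zero_mul, Finset.sum_mul, one_mul]
  split_ifs
  · rw [Finset.sum_comm]
    simp
  · simp

lemma recolorPair_self {n i : ℕ} (hi : i + 1 < n) (a : Fin n → Bool) (t : Bool)
    (h : a ⟨i, by omega⟩ = a ⟨i + 1, hi⟩) :
    recolorPair (recolorPair a i t) i (a ⟨i, by omega⟩) = a := by
  funext j
  simp only [recolorPair]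
  split_ifs with hj
  · rcases hj with hj | hj
    · exact congrArg a (Fin.ext hj.symm)
    · rw [h]
      exact congrArg a (Fin.ext hj.symm)
  · rfl

lemma IsColoring.recolorPair {n m i : ℕ} {hi : i + 1 < n} {D : LinkDiagram n m}
    (hD : D.partner (Sum.inl ⟨i, by omega⟩) = Sum.inl ⟨i + 1, hi⟩) {a : Fin n → Bool}
    {c : Fin m → Bool} (h : IsColoring D a c) (t : Bool) :
    IsColoring D (recolorPair a i t) c := by
  have hD' : D.partner (Sum.inl ⟨i + 1, hi⟩) = Sum.inl ⟨i, by omega⟩ := by rw [← hD, D.invol]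
  have h1 : ∀ x : Fin n ⊕ Fin m, Sum.elim (ValencedTL.recolorPair a i t) c x =
      if x = Sum.inl ⟨i, by omega⟩ ∨ x = Sum.inl ⟨i + 1, hi⟩ then t else Sum.elim a c x := by
    rintro (x | x) <;> simp [ValencedTL.recolorPair, Fin.ext_iff]
  intro x
  rw [h1, h1, h x]
  by_cases hx : x = Sum.inl ⟨i, by omega⟩
  · simp [hx, hD]
  by_cases hx' : x = Sum.inl ⟨i + 1, hi⟩
  · simp [hx', hD']
  have h2 : D.partner x ≠ Sum.inl ⟨i, by omega⟩ := fun e => hx' (by rw [← hD, ← e, D.invol])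
  have h3 : D.partner x ≠ Sum.inl ⟨i + 1, hi⟩ := fun e => hx (by rw [← hD', ← e, D.invol])
  simp [hx, hx', h2, h3]

lemma turnDiagram_mul_of_link {n m i : ℕ} {hi : i + 1 < n} {D : LinkDiagram n m}
    (hD : D.partner (Sum.inl ⟨i, by omega⟩) = Sum.inl ⟨i + 1, hi⟩) :
    colorMatrix (turnDiagram i hi) * colorMatrix D = 2 ^ 1 • colorMatrix D := by
  classical
  ext a c
  rw [colorMatrix_turnDiagram_mul]
  split_ifs with h
  · have h1 : ∀ t, colorMatrix D (recolorPair a i t) c = colorMatrix D a c := by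
      intro t
      have : IsColoring D (recolorPair a i t) c ↔ IsColoring D a c := by
        refine ⟨fun h1 => ?_, fun h1 => h1.recolorPair hD t⟩
        have := h1.recolorPair hD (a ⟨i, by omega⟩)
        rwa [recolorPair_self hi a t h] at this
      simp only [colorMatrix, Matrix.of_apply, this]
    simp [h1]
  · have h1 : ¬ IsColoring D a c := by
      intro h2
      have := h2 (Sum.inl ⟨i, by omega⟩)
      rw [hD] at this
      exact h this.symm
    simp [colorMatrix, h1]

lemma turnDiagram_link {n i : ℕ} (hi : i + 1 < n) :
    (turnDiagram i hi).partner (Sum.inl ⟨i, by omega⟩) = Sum.inl ⟨i + 1, hi⟩ := by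
  simp [turnDiagram, turnPartner]

lemma turnDiagram_right_link {n i : ℕ} (hi : i + 1 < n) :
    (turnDiagram i hi).partner (Sum.inr ⟨i, by omega⟩) = Sum.inr ⟨i + 1, hi⟩ := by
  simp [turnDiagram, turnPartner]

/-- Of the three nested sums over colours, the tests of the two inner generators fix two of the
summation colours; the remaining sum is that of a single generator. -/
lemma turnDiagram_mul_turnDiagram_mul {n i : ℕ} (hi : i + 1 + 1 < n)
    (A : Matrix (Fin n → Bool) (Fin n → Bool) ℕ) :
    colorMatrix (turnDiagram (i + 1) hi) * (colorMatrix (turnDiagram i (by omega)) *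
      (colorMatrix (turnDiagram (i + 1) hi) * A)) = colorMatrix (turnDiagram (i + 1) hi) * A := by
  ext a c
  simp only [colorMatrix_turnDiagram_mul]
  refine if_congr Iff.rfl ?_ rfl
  have h1 : ∀ t r, recolorPair (recolorPair (recolorPair a (i + 1) t) i (a ⟨i, by omega⟩))
      (i + 1) r = recolorPair a (i + 1) r := by
    intro t r
    funext j
    simp only [recolorPair]
    split_ifs with h1 h2
    · rfl
    · exact congrArg a (Fin.ext (by simp; omega))
    · rfl
  have h2 : ∀ t, recolorPair a (i + 1) t ⟨i, by omega⟩ = a ⟨i, by omega⟩ := by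
    intro t
    simp only [recolorPair]
    rw [if_neg (by omega)]
  have h3 : ∀ t, recolorPair a (i + 1) t ⟨i + 1, by omega⟩ = t := by
    simp [recolorPair]
  have h4 : ∀ t s, recolorPair (recolorPair a (i + 1) t) i s ⟨i + 1, by omega⟩ = s := by
    simp [recolorPair]
  have h5 : ∀ t s, recolorPair (recolorPair a (i + 1) t) i s ⟨i + 1 + 1, hi⟩ = t := by
    intro t s
    simp only [recolorPair]
    rw [if_neg (by omega)]
    simp
  simp only [h2, h3, h4, h5, Finset.sum_ite_eq', Finset.sum_ite_eq, Finset.mem_univ, if_true, h1]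

lemma turnDiagram_mul_comm {n i j : ℕ} (hi : i + 1 < n) (hj : j + 1 < n)
    (hij : i + 1 < j) (A : Matrix (Fin n → Bool) (Fin n → Bool) ℕ) :
    colorMatrix (turnDiagram i hi) * (colorMatrix (turnDiagram j hj) * A) =
      colorMatrix (turnDiagram j hj) * (colorMatrix (turnDiagram i hi) * A) := by
  ext a c
  simp only [colorMatrix_turnDiagram_mul]
  have h1 : ∀ t s, recolorPair (recolorPair a i t) j s = recolorPair (recolorPair a j s) i t := by
    intro t s
    funext k
    simp only [recolorPair]
    split_ifs <;> first | rfl | omega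
  have h2 : ∀ t, recolorPair a i t ⟨j, by omega⟩ = a ⟨j, by omega⟩ := fun t => by
    simp only [recolorPair]; rw [if_neg (by omega)]
  have h3 : ∀ t, recolorPair a i t ⟨j + 1, hj⟩ = a ⟨j + 1, hj⟩ := fun t => by
    simp only [recolorPair]; rw [if_neg (by omega)]
  have h4 : ∀ t, recolorPair a j t ⟨i, by omega⟩ = a ⟨i, by omega⟩ := fun t => by
    simp only [recolorPair]; rw [if_neg (by omega)]
  have h5 : ∀ t, recolorPair a j t ⟨i + 1, hi⟩ = a ⟨i + 1, hi⟩ := fun t => by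
    simp only [recolorPair]; rw [if_neg (by omega)]
  simp only [h1, h2, h3, h4, h5]
  rw [Finset.sum_ite_irrel, Finset.sum_ite_irrel, Finset.sum_comm]
  simp only [Finset.sum_const_zero]
  split_ifs <;> rfl

/-! ### Links on the left line -/

/-- An innermost link joins neighbours. Unless `y` follows `x` directly, planarity traps the partner
of `x + 1` strictly between `x` and `y`, which gives a shorter link. -/
lemma exists_adjacent_link {n m : ℕ} (D : LinkDiagram n m) {x y : Fin n} (hxy : x < y)
    (h : D.partner (Sum.inl x) = Sum.inl y) : ∃ (i : ℕ) (hi : i + 1 < n), (x : ℕ) ≤ i ∧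
      i + 1 ≤ (y : ℕ) ∧ D.partner (Sum.inl ⟨i, by omega⟩) = Sum.inl ⟨i + 1, hi⟩ := by
  induction hk : (y : ℕ) - x using Nat.strong_induction_on generalizing x y with
  | _ k ih =>
  have hxy' : (x : ℕ) < y := hxy
  by_cases h1 : (y : ℕ) = x + 1
  · refine ⟨x, by omega, le_rfl, by omega, ?_⟩
    rw [h]
    exact congrArg _ (Fin.ext h1)
  · have hz : (x : ℕ) + 1 < n := by omega
    have h2 := D.planar (Sum.inl x) (Sum.inl ⟨x + 1, hz⟩)
    have h3 := D.planar (D.partner (Sum.inl ⟨x + 1, hz⟩)) (Sum.inl x)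
    rw [h] at h2
    rw [D.invol, h] at h3
    have h5 := D.noFix (Sum.inl ⟨x + 1, hz⟩)
    rcases hw : D.partner (Sum.inl ⟨x + 1, hz⟩) with w | w
    · rw [hw] at h2 h3 h5
      simp only [pos] at h2 h3
      have h6 : (w : ℕ) ≠ x + 1 := fun e => h5 (congrArg _ (Fin.ext e))
      have h7 : (w : ℕ) ≠ x := fun e => by
        have := D.invol (Sum.inl ⟨x + 1, hz⟩)
        rw [hw, show w = x from Fin.ext e, h] at this
        exact h1 (congrArg Fin.val (Sum.inl.inj this))
      have h8 : (w : ℕ) ≠ y := fun e => by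
        have := D.invol (Sum.inl ⟨x + 1, hz⟩)
        rw [hw, show w = y from Fin.ext e, ← h, D.invol] at this
        have := congrArg Fin.val (Sum.inl.inj this)
        simp at this
      obtain ⟨i, hi, h9, h10, h11⟩ := ih ((w : ℕ) - (x + 1)) (by omega)
        (x := ⟨x + 1, hz⟩) (y := w) (Fin.lt_def.2 (by simp; omega)) hw rfl
      simp only at h9
      exact ⟨i, hi, by omega, by omega, h11⟩
    · rw [hw] at h2
      simp only [pos] at h2
      omega

/-- Every left node crosses to the right, and planarity makes this map strictly increasing; a
strictly increasing self-map of `Fin n` is the identity. -/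
lemma eq_unitDiagram {n : ℕ} (D : LinkDiagram n n)
    (h : ∀ x y, D.partner (Sum.inl x) ≠ Sum.inl y) : D = unitDiagram n := by
  have h1 : ∀ x, ∃ y, D.partner (Sum.inl x) = Sum.inr y := by
    intro x
    rcases hx : D.partner (Sum.inl x) with y | y
    · exact absurd hx (h x y)
    · exact ⟨y, rfl⟩
  choose g hg using h1
  have hmono : StrictMono g := by
    intro x y hxy
    have h2 := D.planar (Sum.inl x) (Sum.inl y)
    rw [hg, hg] at h2
    have h3 : g x ≠ g y := fun e => by
      have : Sum.inl x = (Sum.inl y : Fin n ⊕ Fin n) := by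
        rw [← D.invol (Sum.inl x), hg, e, ← hg, D.invol]
      exact hxy.ne (Sum.inl.inj this)
    simp only [pos, Fin.val_rev] at h2
    rw [Fin.lt_def] at hxy ⊢
    have := Fin.val_ne_of_ne h3
    omega
  have hid : ∀ x, g x = x := fun x =>
    le_antisymm hmono.apply_le hmono.le_apply
  ext1
  funext x
  rcases x with x | x
  · rw [hg, hid]; rfl
  · have := hg x
    rw [hid] at this
    rw [← this, D.invol, this]; rfl

lemma exists_left_link {n : ℕ} {D : LinkDiagram n n} (h : D ≠ unitDiagram n) :
    ∃ x y, D.partner (Sum.inl x) = Sum.inl y := by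
  by_contra h1
  push Not at h1
  exact h (eq_unitDiagram D h1)

lemma reflect_partner_inl {n m : ℕ} (D : LinkDiagram n m) (x y : Fin m) :
    (reflect D).partner (Sum.inl x) = Sum.inl y ↔ D.partner (Sum.inr x) = Sum.inr y := by
  simp only [reflect, Sum.swap_inl]
  rcases D.partner (Sum.inr x) with z | z <;> simp

lemma exists_right_link {n : ℕ} {D : LinkDiagram n n} (h : D ≠ unitDiagram n) :
    ∃ x y, D.partner (Sum.inr x) = Sum.inr y := by
  have h1 : reflect D ≠ unitDiagram n := fun e => h (by
    rw [← reflect_reflect D, e, reflect_unitDiagram])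
  obtain ⟨x, y, hxy⟩ := exists_left_link h1
  exact ⟨x, y, (reflect_partner_inl D x y).1 hxy⟩

/-! ### Quantum integers -/

/-- The quantum integer `[k]` as a function of `ν = -[2]`. -/
def quantumInt (ν : ℂ) : ℕ → ℂ
  | 0 => 0
  | 1 => 1
  | k + 2 => -ν * quantumInt ν (k + 1) - quantumInt ν k

lemma quantumInt_mul {q : ℂ} (hq : q ≠ 0) (k : ℕ) :
    quantumInt (fugacity q) k * (q - q⁻¹) = q ^ k - q⁻¹ ^ k := by
  induction k using Nat.twoStepInduction with
  | zero => simp [quantumInt]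
  | one => simp [quantumInt]
  | more k h1 h2 =>
    have h3 : q * q⁻¹ = 1 := mul_inv_cancel₀ hq
    calc quantumInt (fugacity q) (k + 2) * (q - q⁻¹)
        = (q + q⁻¹) * (quantumInt (fugacity q) (k + 1) * (q - q⁻¹)) -
            quantumInt (fugacity q) k * (q - q⁻¹) := by
          simp only [quantumInt, fugacity]; ring
      _ = q ^ (k + 2) - q⁻¹ ^ (k + 2) := by
          rw [h1, h2]
          linear_combination (q ^ k - q⁻¹ ^ k) * h3

lemma quantumInt_of_sq {q : ℂ} (hq : q = 1 ∨ q = -1) (k : ℕ) :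
    quantumInt (fugacity q) k * q = k * q ^ k := by
  have h1 : fugacity q = -2 * q := by rcases hq with rfl | rfl <;> simp [fugacity] <;> norm_num
  have h2 : q ^ 2 = 1 := by rcases hq with rfl | rfl <;> norm_num
  induction k using Nat.twoStepInduction with
  | zero => simp [quantumInt]
  | one => simp [quantumInt]
  | more k h3 h4 =>
    rw [quantumInt, sub_mul, mul_assoc, h3, h4, h1]
    push_cast
    linear_combination ((k : ℂ) * q ^ k) * h2

lemma minPower_le {q : ℂ} {k : ℕ} (hk : 0 < k) (h : q ^ (2 * k) = 1) (h1 : q ≠ 1) :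
    minPower q ≤ k := by
  have : NeZero (2 * k) := ⟨by omega⟩
  obtain ⟨j, hj, hjq⟩ := (Complex.mem_rootsOfUnity (2 * k) (Units.mk0 q (by
    rintro rfl
    simp [hk.ne'] at h))).1 (by
      rw [mem_rootsOfUnity]
      ext
      simpa using h)
  simp only [Units.val_mk0] at hjq
  -- The numerator `p'` in `minPower` has to be positive; `j = 0` would mean `q = 1`.
  have hj0 : 0 < j := by
    rcases Nat.eq_zero_or_pos j with rfl | h2
    · simp at hjq
      exact absurd hjq.symm h1
    · exact h2
  obtain ⟨g, a, b, hg, hab, rfl, rfl⟩ :=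
    Nat.exists_coprime' (m := j) (n := k) (Nat.gcd_pos_of_pos_left _ hj0)
  have hb : 0 < b := Nat.pos_of_mul_pos_right hk
  have ha : 0 < a := Nat.pos_of_mul_pos_right hj0
  calc minPower q ≤ (b : ℕ∞) := by
        refine sInf_le ⟨b, a, hb, ha, hab.symm, ?_, rfl⟩
        rw [← hjq]
        congr 1
        have : (b : ℂ) ≠ 0 := by exact_mod_cast hb.ne'
        have : (g : ℂ) ≠ 0 := by exact_mod_cast hg.ne'
        push_cast
        field_simp
    _ ≤ ((b * g : ℕ) : ℕ∞) := by exact_mod_cast Nat.le_mul_of_pos_right b hg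

/-- For `q ≠ ±1`, a zero of `[k]` forces `q ^ (2 * k) = 1`, hence `minPower q ≤ k`. At `q = ±1`,
where dividing by `q - q⁻¹` is impossible, `[k]` is `k` up to sign. -/
lemma quantumInt_ne_zero {q : ℂ} (hq : q ≠ 0) {s k : ℕ} (hs : (s : ℕ∞) < minPowerBar q)
    (hk : 0 < k) (hks : k ≤ s) : quantumInt (fugacity q) k ≠ 0 := by
  intro h0
  by_cases h1 : q = 1 ∨ q = -1
  · have h2 := quantumInt_of_sq h1 k
    rw [h0, zero_mul] at h2
    have h3 : (k : ℂ) ≠ 0 := by exact_mod_cast hk.ne'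
    exact mul_ne_zero h3 (pow_ne_zero k hq) h2.symm
  · have h2 := quantumInt_mul hq k
    rw [h0, zero_mul] at h2
    have h3 : q ^ (2 * k) = 1 := by
      have h4 : q ^ k * q⁻¹ ^ k = 1 := by rw [← mul_pow, mul_inv_cancel₀ hq, one_pow]
      rw [two_mul, pow_add]
      rw [← sub_eq_zero.1 h2.symm] at h4
      exact h4
    rw [minPowerBar, if_neg h1] at hs
    push Not at h1
    have h4 := hs.trans_le (minPower_le hk h3 h1.1)
    exact absurd (Nat.cast_lt.1 h4) (by omega)

/-! ### The Wenzl recursion -/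

section Wenzl

variable {A : Type*} [Ring A] [Algebra ℂ A]

/-- The Wenzl recursion. -/
def wenzl (ν : ℂ) (u : ℕ → A) : ℕ → A
  | 0 => 1
  | k + 1 => wenzl ν u k + (quantumInt ν (k + 1) / quantumInt ν (k + 2)) •
      (wenzl ν u k * u k * wenzl ν u k)

lemma commute_wenzl {ν : ℂ} {u : ℕ → A} (hcomm : ∀ i j, i + 1 < j → u i * u j = u j * u i)
    {k j : ℕ} (h : k < j) : Commute (u j) (wenzl ν u k) := by
  induction k with
  | zero => exact Commute.one_right _
  | succ k ih =>
    have h1 := ih (by omega)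
    have h2 : Commute (u j) (u k) := (hcomm k j h).symm
    exact h1.add_right (((h1.mul_right h2).mul_right h1).smul_right _)

/-- `wenzl ν u k` is the projector on `k + 1` strands. The element `y` stands for the previous
projector, with `1` in its place when `k = 0`; only its absorption by `wenzl ν u k` and its
commutation with `u k` are needed. The scalar in the last clause is what makes the correction term
of the next step cancel. -/
lemma wenzl_spec {ν : ℂ} {u : ℕ → A} (hsq : ∀ i, u i * u i = ν • u i)
    (hbraid : ∀ i, u (i + 1) * u i * u (i + 1) = u (i + 1))
    (hcomm : ∀ i j, i + 1 < j → u i * u j = u j * u i) (k : ℕ)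
    (hQ : ∀ i ≤ k, quantumInt ν (i + 1) ≠ 0) :
    wenzl ν u k * wenzl ν u k = wenzl ν u k ∧
      (∀ i < k, u i * wenzl ν u k = 0 ∧ wenzl ν u k * u i = 0) ∧
      ∃ y, u k * wenzl ν u k * u k = (-quantumInt ν (k + 2) / quantumInt ν (k + 1)) • (u k * y) ∧
        y * wenzl ν u k = wenzl ν u k ∧ wenzl ν u k * y = wenzl ν u k ∧ u k * y = y * u k := by
  induction k with
  | zero =>
    refine ⟨by simp [wenzl], by simp, 1, ?_, by simp, by simp, by simp⟩
    simp [wenzl, hsq, quantumInt]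
  | succ k ih =>
    obtain ⟨idem, kill, y, h1, h2, h3, h4⟩ := ih fun i hi => hQ i (by omega)
    have q1 := hQ k (by omega)
    have q2 := hQ (k + 1) le_rfl
    set r := wenzl ν u k with hr
    have hr' : wenzl ν u (k + 1) = r + (quantumInt ν (k + 1) / quantumInt ν (k + 2)) •
      (r * u k * r) := rfl
    rw [hr']
    set c := quantumInt ν (k + 1) / quantumInt ν (k + 2) with hc
    have hcd : c * (-quantumInt ν (k + 2) / quantumInt ν (k + 1)) = -1 := by
      rw [hc]; field_simp
    have k1 : u k * (r + c • (r * u k * r)) = 0 := by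
      calc u k * (r + c • (r * u k * r)) = u k * r + c • ((u k * r * u k) * r) := by
            rw [mul_add, mul_smul_comm]; simp only [mul_assoc]
        _ = 0 := by
            rw [h1, smul_mul_assoc, smul_smul, hcd, mul_assoc, h2, neg_one_smul, add_neg_cancel]
    have k2 : (r + c • (r * u k * r)) * u k = 0 := by
      calc (r + c • (r * u k * r)) * u k = r * u k + c • (r * (u k * r * u k)) := by
            rw [add_mul, smul_mul_assoc]; simp only [mul_assoc]
        _ = 0 := by
            rw [h1, mul_smul_comm, smul_smul, hcd, h4, ← mul_assoc, h3, neg_one_smul,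
              add_neg_cancel]
    have rr : (r + c • (r * u k * r)) * r = r + c • (r * u k * r) := by
      rw [add_mul, smul_mul_assoc, mul_assoc _ r r, idem]
    have rr' : r * (r + c • (r * u k * r)) = r + c • (r * u k * r) := by
      rw [mul_add, mul_smul_comm, ← mul_assoc, ← mul_assoc, idem]
    -- The old projector `r` becomes the new `y`. Its scalar is `ν + c`, which the recursion for
    -- quantum integers turns into `-[k + 3] / [k + 2]`.
    refine ⟨?_, fun i hi => ?_, r, ?_, rr', rr, commute_wenzl hcomm (Nat.lt_succ_self k)⟩
    · rw [mul_add, rr, mul_smul_comm, ← mul_assoc, ← mul_assoc, rr, k2, zero_mul, smul_zero,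
        add_zero]
    · rcases Nat.lt_succ_iff_lt_or_eq.1 hi with hi | rfl
      · constructor
        · rw [← rr', ← mul_assoc, (kill i hi).1, zero_mul]
        · rw [← rr, mul_assoc, (kill i hi).2, mul_zero]
      · exact ⟨k1, k2⟩
    · have h5 : u (k + 1) * r = r * u (k + 1) := commute_wenzl hcomm (Nat.lt_succ_self k)
      have e1 : u (k + 1) * r * u (k + 1) = ν • (u (k + 1) * r) := by
        rw [mul_assoc, ← h5, ← mul_assoc, hsq, smul_mul_assoc]
      have e2 : u (k + 1) * (r * u k * r) * u (k + 1) = u (k + 1) * r := by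
        calc u (k + 1) * (r * u k * r) * u (k + 1)
            = (u (k + 1) * r) * u k * (r * u (k + 1)) := by simp only [mul_assoc]
          _ = r * (u (k + 1) * u k * u (k + 1)) * r := by
              rw [← h5]; nth_rewrite 1 [h5]; simp only [mul_assoc]
          _ = u (k + 1) * r := by rw [hbraid, ← h5, mul_assoc, idem]
      rw [mul_add, add_mul, e1, mul_smul_comm, smul_mul_assoc, e2, ← add_smul]
      congr 1
      have : quantumInt ν (k + 1 + 2) = -ν * quantumInt ν (k + 2) - quantumInt ν (k + 1) := rfl
      rw [this, hc]
      have q2' : quantumInt ν (k + 2) ≠ 0 := q2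
      field_simp
      ring

/-- Each correction term ends in a generator times an earlier projector, which `ε` does not see by
induction. Applied to the coefficient of the unit diagram, this shows that the projector is nonzero.
-/
lemma apply_mul_wenzl {ν : ℂ} {u : ℕ → A} (ε : A →ₗ[ℂ] ℂ) (hε : ∀ x i, ε (x * u i) = 0) (k : ℕ)
    (x : A) : ε (x * wenzl ν u k) = ε x := by
  induction k generalizing x with
  | zero => simp [wenzl]
  | succ k ih =>
    rw [wenzl, mul_add, mul_smul_comm, map_add, map_smul, ← mul_assoc, ih, ih, ← mul_assoc, hε,
      smul_zero, add_zero]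

end Wenzl

/-! ### Existence and uniqueness of the Jones-Wenzl projector -/

/-- The Temperley-Lieb algebra. -/
def TLAlgebra (_ν : ℂ) (n : ℕ) : Type := Tangle n n

instance (ν : ℂ) (n : ℕ) : AddCommGroup (TLAlgebra ν n) :=
  inferInstanceAs (AddCommGroup (Tangle n n))

instance (ν : ℂ) (n : ℕ) : Module ℂ (TLAlgebra ν n) := inferInstanceAs (Module ℂ (Tangle n n))

instance (ν : ℂ) (n : ℕ) : Ring (TLAlgebra ν n) where
  __ := (inferInstance : AddCommGroup (TLAlgebra ν n))
  mul x y := comp ν x y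
  one := unitTangle n
  mul_assoc := comp_assoc ν
  one_mul := unitTangle_comp ν
  mul_one := comp_unitTangle ν
  left_distrib x y z := map_add (comp ν x) y z
  right_distrib x y z := LinearMap.map_add₂ (comp ν) x y z
  zero_mul x := LinearMap.map_zero₂ (comp ν) x
  mul_zero x := map_zero (comp ν x)

instance (ν : ℂ) (n : ℕ) : Algebra ℂ (TLAlgebra ν n) :=
  Algebra.ofModule (fun c x y => LinearMap.map_smul₂ (comp ν) c x y)
    (fun c x y => map_smul (comp ν x) c y)

/-- A tangle as an element of the Temperley-Lieb algebra. -/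
def toTL (ν : ℂ) {n : ℕ} : Tangle n n ≃ₗ[ℂ] TLAlgebra ν n := LinearEquiv.refl ℂ _

lemma toTL_mul (ν : ℂ) {n : ℕ} (x y : Tangle n n) : toTL ν x * toTL ν y = toTL ν (comp ν x y) :=
  rfl

lemma toTL_symm_mul (ν : ℂ) {n : ℕ} (x y : TLAlgebra ν n) :
    (toTL ν).symm (x * y) = comp ν ((toTL ν).symm x) ((toTL ν).symm y) :=
  rfl

lemma toTL_symm_one (ν : ℂ) {n : ℕ} : (toTL ν).symm (1 : TLAlgebra ν n) = unitTangle n := rfl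

/-- The generators of the Temperley-Lieb algebra, extended by zero. -/
def generator (ν : ℂ) (n i : ℕ) : TLAlgebra ν n :=
  if h : i + 1 < n then toTL ν (Finsupp.single (turnDiagram i h) 1) else 0

/-- The coefficient of the unit diagram. -/
def unitCoeff (n : ℕ) : Tangle n n →ₗ[ℂ] ℂ := Finsupp.lapply (unitDiagram n)

lemma unitCoeff_single_of_ne {n : ℕ} {D : LinkDiagram n n} (h : D ≠ unitDiagram n) (x : ℂ) :
    unitCoeff n (Finsupp.single D x) = 0 := by
  simp [unitCoeff, h]

lemma unitCoeff_unitTangle (n : ℕ) : unitCoeff n (unitTangle n) = 1 := by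
  simp [unitCoeff, unitTangle]

lemma ne_unitDiagram_of_left_link {n : ℕ} {D : LinkDiagram n n} {x y : Fin n}
    (h : D.partner (Sum.inl x) = Sum.inl y) : D ≠ unitDiagram n := by
  rintro rfl
  simp [unitDiagram] at h

lemma ne_unitDiagram_of_right_link {n : ℕ} {D : LinkDiagram n n} {x y : Fin n}
    (h : D.partner (Sum.inr x) = Sum.inr y) : D ≠ unitDiagram n := by
  rintro rfl
  simp [unitDiagram] at h

lemma unitCoeff_single_comp {n m : ℕ} (ν : ℂ) {D : LinkDiagram n m} {x y : Fin n}
    (h : D.partner (Sum.inl x) = Sum.inl y) (c : ℂ) (z : Tangle m n) :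
    unitCoeff n (comp ν (Finsupp.single D c) z) = 0 := by
  induction z using Finsupp.induction_linear with
  | zero => simp
  | add f g hf hg => rw [map_add, map_add, hf, hg, add_zero]
  | single U a =>
    obtain ⟨E, l, hE⟩ := exists_colorMatrix_mul D U
    rw [comp_single_eq hE,
      unitCoeff_single_of_ne (ne_unitDiagram_of_left_link (concat_left_link hE h))]

lemma unitCoeff_comp_single {n m : ℕ} (ν : ℂ) {D : LinkDiagram m n} {x y : Fin n}
    (h : D.partner (Sum.inr x) = Sum.inr y) (c : ℂ) (z : Tangle n m) :
    unitCoeff n (comp ν z (Finsupp.single D c)) = 0 := by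
  induction z using Finsupp.induction_linear with
  | zero => simp
  | add f g hf hg => rw [map_add, LinearMap.add_apply, map_add, hf, hg, add_zero]
  | single U a =>
    obtain ⟨E, l, hE⟩ := exists_colorMatrix_mul U D
    rw [comp_single_eq hE,
      unitCoeff_single_of_ne (ne_unitDiagram_of_right_link (concat_right_link hE h))]

lemma comp_turnDiagram_of_link (ν : ℂ) {n m i : ℕ} {hi : i + 1 < n} {D : LinkDiagram n m}
    (hD : D.partner (Sum.inl ⟨i, by omega⟩) = Sum.inl ⟨i + 1, hi⟩) (x : ℂ) :
    comp ν (Finsupp.single (turnDiagram i hi) 1) (Finsupp.single D x) =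
      ν • Finsupp.single D x := by
  rw [comp_single_eq (turnDiagram_mul_of_link hD)]
  simp [mul_comm]

lemma generator_mul_self (ν : ℂ) (n i : ℕ) :
    generator ν n i * generator ν n i = ν • generator ν n i := by
  by_cases h : i + 1 < n
  · rw [generator, dif_pos h, toTL_mul, comp_turnDiagram_of_link ν (turnDiagram_link h), map_smul]
  · simp [generator, h]

lemma generator_braid (ν : ℂ) (n i : ℕ) :
    generator ν n (i + 1) * generator ν n i * generator ν n (i + 1) = generator ν n (i + 1) := by
  by_cases h : i + 1 + 1 < n
  · have h' : i + 1 < n := by omega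
    rw [generator, dif_pos h, generator, dif_pos h', toTL_mul, toTL_mul, comp_assoc]
    obtain ⟨D, l, hD⟩ := exists_colorMatrix_mul (turnDiagram i h') (turnDiagram (i + 1) h)
    obtain ⟨E, k, hE⟩ := exists_colorMatrix_mul (turnDiagram (i + 1) h) D
    have h1 := turnDiagram_mul_turnDiagram_mul h 1
    rw [Matrix.mul_one, hD, Matrix.mul_smul, hE, smul_smul, ← pow_add] at h1
    obtain ⟨h2, rfl⟩ := colorMatrix_smul_inj (k := 0) (h1.trans (by rw [pow_zero, one_smul]))
    rw [comp_single_eq hD, comp_single_eq hE]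
    obtain ⟨rfl, rfl⟩ : l = 0 ∧ k = 0 := by omega
    simp
  · simp [generator, h]

lemma generator_comm (ν : ℂ) (n i j : ℕ) (hij : i + 1 < j) :
    generator ν n i * generator ν n j = generator ν n j * generator ν n i := by
  by_cases h : j + 1 < n
  · have h' : i + 1 < n := by omega
    rw [generator, dif_pos h', generator, dif_pos h, toTL_mul, toTL_mul]
    obtain ⟨D, l, hD⟩ := exists_colorMatrix_mul (turnDiagram i h') (turnDiagram j h)
    have h1 := turnDiagram_mul_comm h' h hij 1
    rw [Matrix.mul_one, Matrix.mul_one, hD] at h1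
    rw [comp_single_eq hD, comp_single_eq h1.symm]
  · simp [generator, h]

lemma exists_isJonesWenzl {ν : ℂ} {s : ℕ} (hQ : ∀ k, 0 < k → k ≤ s → quantumInt ν k ≠ 0) :
    ∃ P : Tangle s s, IsJonesWenzl ν P := by
  -- The recursion starts at one strand, so the empty projector is treated separately.
  rcases s with - | s
  · refine ⟨unitTangle 0, fun h => ?_, comp_unitTangle ν _, fun i hi => by omega⟩
    have := unitCoeff_unitTangle 0
    rw [h] at this
    simp at this
  · obtain ⟨h1, h2, -⟩ := wenzl_spec (generator_mul_self ν (s + 1)) (generator_braid ν (s + 1))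
      (generator_comm ν (s + 1)) s fun i hi => hQ (i + 1) (by omega) (by omega)
    have hgen : ∀ i (hi : i + 1 < s + 1), (toTL ν).symm (generator ν (s + 1) i) =
        Finsupp.single (turnDiagram i hi) 1 := fun i hi => by
      rw [generator, dif_pos hi, LinearEquiv.symm_apply_apply]
    refine ⟨(toTL ν).symm (wenzl ν (generator ν (s + 1)) s), fun h => ?_, ?_, fun i hi => ?_⟩
    · have h3 := apply_mul_wenzl (ν := ν) (u := generator ν (s + 1))
        (unitCoeff (s + 1) ∘ₗ (toTL ν).symm.toLinearMap) (fun x i => ?_) s 1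
      · rw [one_mul, LinearMap.comp_apply, LinearMap.comp_apply, LinearEquiv.coe_coe, h, map_zero,
          toTL_symm_one, unitCoeff_unitTangle] at h3
        exact zero_ne_one h3
      · rw [LinearMap.comp_apply, LinearEquiv.coe_coe, toTL_symm_mul]
        by_cases hi : i + 1 < s + 1
        · rw [hgen i hi, unitCoeff_comp_single ν (turnDiagram_right_link hi)]
        · rw [generator, dif_neg hi, map_zero, map_zero, map_zero]
    · rw [← toTL_symm_mul, h1]
    · have := h2 i (by omega)
      rw [← hgen i hi, ← toTL_symm_mul, ← toTL_symm_mul, this.1, this.2, map_zero]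
      exact ⟨rfl, rfl⟩

/-! ### Properties of the Jones-Wenzl projector -/

lemma map_eq_unitCoeff_smul {n : ℕ} {M : Type*} [AddCommGroup M] [Module ℂ M]
    (F : Tangle n n →ₗ[ℂ] M) (hF : ∀ D, D ≠ unitDiagram n → F (Finsupp.single D 1) = 0)
    (x : Tangle n n) : F x = unitCoeff n x • F (unitTangle n) := by
  have h : F = (unitCoeff n).smulRight (F (unitTangle n)) := by
    refine Finsupp.lhom_ext' fun D => LinearMap.ext_ring ?_
    simp only [LinearMap.comp_apply, Finsupp.lsingle_apply, LinearMap.smulRight_apply]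
    by_cases hD : D = unitDiagram n
    · subst hD
      have := unitCoeff_unitTangle n
      rw [unitTangle] at this ⊢
      rw [this, one_smul]
    · rw [hF D hD, unitCoeff_single_of_ne hD, zero_smul]
  exact congrArg (fun G => G x) h

lemma single_eq_smul {α : Type*} (D : α) (x : ℂ) :
    (Finsupp.single D x : α →₀ ℂ) = x • Finsupp.single D 1 := by
  simp

lemma exists_adjacent_link' {n m : ℕ} (D : LinkDiagram n m) {x y : Fin n}
    (h : D.partner (Sum.inl x) = Sum.inl y) : ∃ (i : ℕ) (hi : i + 1 < n),
      min (x : ℕ) y ≤ i ∧ i + 1 ≤ max (x : ℕ) y ∧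
      D.partner (Sum.inl ⟨i, by omega⟩) = Sum.inl ⟨i + 1, hi⟩ := by
  rcases lt_trichotomy x y with hxy | rfl | hxy
  · obtain ⟨i, hi, h1, h2, h3⟩ := exists_adjacent_link D hxy h
    exact ⟨i, hi, by omega, by omega, h3⟩
  · exact absurd h (D.noFix _)
  · obtain ⟨i, hi, h1, h2, h3⟩ := exists_adjacent_link D hxy (by rw [← h, D.invol])
    exact ⟨i, hi, by omega, by omega, h3⟩

/-- The link closes a loop with the generator, so `ν • P D = P U_i D = 0`, and `ν` can be cancelled.
-/
lemma comp_eq_zero_of_link {ν : ℂ} (hν : ν ≠ 0) {n m i : ℕ} {hi : i + 1 < n} {P : Tangle n n}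
    (hP : comp ν P (Finsupp.single (turnDiagram i hi) 1) = 0) {D : LinkDiagram n m}
    (hD : D.partner (Sum.inl ⟨i, by omega⟩) = Sum.inl ⟨i + 1, hi⟩) (x : ℂ) :
    comp ν P (Finsupp.single D x) = 0 := by
  have h := comp_assoc ν P (Finsupp.single (turnDiagram i hi) 1) (Finsupp.single D x)
  rw [comp_turnDiagram_of_link ν hD, hP, map_smul] at h
  exact (smul_eq_zero.1 h.symm).resolve_left hν

lemma reflect_turnDiagram {n i : ℕ} (hi : i + 1 < n) :
    reflect (turnDiagram i hi) = turnDiagram i hi := by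
  refine ext_of_isColoring fun a b h => ?_
  rw [isColoring_reflect, isColoring_turnDiagram] at h
  rw [isColoring_turnDiagram]
  exact ⟨h.2.1, h.1, fun j h1 h2 => (h.2.2 j h1 h2).symm⟩

namespace IsJonesWenzl

variable {ν : ℂ} {s : ℕ} {P P' : Tangle s s}

lemma flip (hP : IsJonesWenzl ν P) : IsJonesWenzl ν (flip P) := by
  obtain ⟨h1, h2, h3⟩ := hP
  refine ⟨fun h => h1 ?_, ?_, fun i hi => ?_⟩
  · rw [← flip_flip P, h, map_zero]
  · rw [← flip_comp, h2]
  · have h4 : (Finsupp.single (turnDiagram i hi) 1 : Tangle s s) =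
        ValencedTL.flip (Finsupp.single (turnDiagram i hi) 1) := by
      rw [flip_single, reflect_turnDiagram]
    rw [h4, ← flip_comp, ← flip_comp, (h3 i hi).1, (h3 i hi).2, map_zero]
    exact ⟨rfl, rfl⟩

lemma comp_single_eq_zero (hP : IsJonesWenzl ν P) (hν : 2 ≤ s → ν ≠ 0) {m : ℕ}
    {D : LinkDiagram s m} {x y : Fin s} (hD : D.partner (Sum.inl x) = Sum.inl y) :
    comp ν P (Finsupp.single D 1) = 0 := by
  obtain ⟨i, hi, -, -, h⟩ := exists_adjacent_link' D hD
  exact comp_eq_zero_of_link (hν (by omega)) (hP.2.2 i hi).2 h 1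

lemma single_comp_eq_zero (hP : IsJonesWenzl ν P) (hν : 2 ≤ s → ν ≠ 0) {m : ℕ}
    {D : LinkDiagram m s} {x y : Fin s} (hD : D.partner (Sum.inr x) = Sum.inr y) :
    comp ν (Finsupp.single D 1) P = 0 := by
  rw [← flip_flip (comp ν _ P), flip_comp, flip_single,
    hP.flip.comp_single_eq_zero hν ((reflect_partner_inl D x y).2 hD), map_zero]

/-- Non-unit diagrams have a link on the left line and are annihilated, so only the unit coefficient
matters. The condition on `ν` is needed only when there are at least two nodes, as any such link
requires. -/
lemma comp_eq (hP : IsJonesWenzl ν P) (hν : 2 ≤ s → ν ≠ 0) (x : Tangle s s) :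
    comp ν P x = unitCoeff s x • P := by
  rw [map_eq_unitCoeff_smul (comp ν P) (fun D hD => ?_), comp_unitTangle]
  obtain ⟨x, y, h⟩ := exists_left_link hD
  exact hP.comp_single_eq_zero hν h

lemma comp_eq' (hP : IsJonesWenzl ν P) (hν : 2 ≤ s → ν ≠ 0) (x : Tangle s s) :
    comp ν x P = unitCoeff s x • P := by
  have h := map_eq_unitCoeff_smul ((comp ν).flip P) (fun D hD => ?_) x
  · rwa [LinearMap.flip_apply, LinearMap.flip_apply, unitTangle_comp] at h
  · obtain ⟨x, y, h⟩ := exists_right_link hD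
    rw [LinearMap.flip_apply]
    exact hP.single_comp_eq_zero hν h

lemma unitCoeff_eq (hP : IsJonesWenzl ν P) (hν : 2 ≤ s → ν ≠ 0) : unitCoeff s P = 1 := by
  have h := hP.comp_eq hν P
  rw [hP.2.1] at h
  have h1 : (1 - unitCoeff s P) • P = 0 := by rw [sub_smul, one_smul, ← h, sub_self]
  rcases smul_eq_zero.1 h1 with h2 | h2
  · exact (sub_eq_zero.1 h2).symm
  · exact absurd h2 hP.1

/-- The product of the two projectors, evaluated by absorption into either factor, equals each of
them, both having unit coefficient one. -/
lemma unique (hP : IsJonesWenzl ν P) (hP' : IsJonesWenzl ν P') (hν : 2 ≤ s → ν ≠ 0) :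
    P = P' := by
  have h1 := hP.comp_eq hν P'
  rw [hP'.comp_eq' hν P, hP.unitCoeff_eq hν, hP'.unitCoeff_eq hν, one_smul, one_smul] at h1
  exact h1.symm

end IsJonesWenzl

/-! ### Stacks -/

section Stack

variable {d : ℕ} {ς : Fin d → ℕ}

/-- The colours of the link ends at one node. -/
def block {d : ℕ} (ς : Fin d → ℕ) (a : Fin (∑ i, ς i) → Bool) (i : Fin d) : Fin (ς i) → Bool :=
  fun u => a (finSigmaFinEquiv ⟨i, u⟩)

lemma isColoring_stack (D : ∀ i, LinkDiagram (ς i) (ς i)) (a b : Fin (∑ i, ς i) → Bool) :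
    IsColoring (stack D) a b ↔ ∀ i, IsColoring (D i) (block ς a i) (block ς b i) := by
  have h : ∀ i u, Sum.elim a b (stackEquiv ς ⟨i, u⟩) = Sum.elim (block ς a i) (block ς b i) u := by
    rintro i (u | u) <;> rfl
  have h1 : ∀ i u, (stack D).partner (stackEquiv ς ⟨i, u⟩) = stackEquiv ς ⟨i, (D i).partner u⟩ := by
    intro i u
    show stackEquiv ς (stackPartner D ((stackEquiv ς).symm (stackEquiv ς ⟨i, u⟩))) = _
    rw [Equiv.symm_apply_apply, stackPartner]
  rw [IsColoring, (stackEquiv ς).surjective.forall]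
  simp only [Sigma.forall, h1, h]
  rfl

lemma colorMatrix_stack (D : ∀ i, LinkDiagram (ς i) (ς i)) (a b : Fin (∑ i, ς i) → Bool) :
    colorMatrix (stack D) a b = ∏ i, colorMatrix (D i) (block ς a i) (block ς b i) := by
  classical
  simp only [colorMatrix, Matrix.of_apply, isColoring_stack]
  rw [Finset.prod_ite_zero]
  simp

/-- Splitting a colouring into blocks. -/
def blockEquiv {d : ℕ} (ς : Fin d → ℕ) :
    (Fin (∑ i, ς i) → Bool) ≃ (∀ i, Fin (ς i) → Bool) :=
  (Equiv.arrowCongr finSigmaFinEquiv.symm (Equiv.refl Bool)).trans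
    (Equiv.piCurry fun _ _ => Bool)

/-- The matrix of a stack is the Kronecker product of the matrices of its blocks, and Kronecker
products multiply factorwise; loops add up. -/
lemma colorMatrix_stack_mul {D E F : ∀ i, LinkDiagram (ς i) (ς i)} {l : Fin d → ℕ}
    (h : ∀ i, colorMatrix (D i) * colorMatrix (E i) = 2 ^ l i • colorMatrix (F i)) :
    colorMatrix (stack D) * colorMatrix (stack E) = 2 ^ (∑ i, l i) • colorMatrix (stack F) := by
  ext a c
  rw [Matrix.mul_apply, Matrix.smul_apply, colorMatrix_stack, smul_eq_mul,
    ← Finset.prod_pow_eq_pow_sum, ← Finset.prod_mul_distrib]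
  have h1 : ∀ i, 2 ^ l i * colorMatrix (F i) (block ς a i) (block ς c i) =
      ∑ b, colorMatrix (D i) (block ς a i) b * colorMatrix (E i) b (block ς c i) := by
    intro i
    rw [← Matrix.mul_apply, h]
    rfl
  simp only [h1, Finset.prod_univ_sum, Fintype.piFinset_univ]
  rw [← (blockEquiv ς).sum_comp]
  refine Finset.sum_congr rfl fun b _ => ?_
  rw [colorMatrix_stack, colorMatrix_stack, ← Finset.prod_mul_distrib]
  rfl

lemma reflect_stack (D : ∀ i, LinkDiagram (ς i) (ς i)) :
    reflect (stack D) = stack fun i => reflect (D i) := by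
  refine ext_of_isColoring fun a b h => ?_
  rw [isColoring_reflect, isColoring_stack] at h
  rw [isColoring_stack]
  exact fun i => (isColoring_reflect _ _ _).2 (h i)

/-- Placing tangles below each other. -/
def stackTangle {d : ℕ} {ς : Fin d → ℕ} (x : ∀ i, Tangle (ς i) (ς i)) :
    Tangle (∑ i, ς i) (∑ i, ς i) :=
  ∑ D : (∀ i, LinkDiagram (ς i) (ς i)), Finsupp.single (stack D) (∏ i, x i (D i))

lemma compositeProjector_eq (ν : ℂ) (ς : Fin d → ℕ) :
    compositeProjector ν ς = stackTangle fun i => jonesWenzl ν (ς i) := rfl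

lemma stackTangle_single (D : ∀ i, LinkDiagram (ς i) (ς i)) (c : Fin d → ℂ) :
    stackTangle (fun i => Finsupp.single (D i) (c i)) = Finsupp.single (stack D) (∏ i, c i) := by
  classical
  rw [stackTangle, Finset.sum_eq_single D]
  · simp
  · intro E _ hE
    obtain ⟨i, hi⟩ := Function.ne_iff.1 hE
    rw [Finset.prod_eq_zero (Finset.mem_univ i), Finsupp.single_zero]
    exact Finsupp.single_eq_of_ne hi
  · simp

lemma concat_stack (ν : ℂ) (D E : ∀ i, LinkDiagram (ς i) (ς i)) :
    concat ν (stack D) (stack E) = stackTangle fun i => concat ν (D i) (E i) := by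
  choose F l h using fun i => exists_colorMatrix_mul (D i) (E i)
  rw [concat_eq (colorMatrix_stack_mul h), ← Finset.prod_pow_eq_pow_sum, ← stackTangle_single]
  congr 1
  funext i
  rw [concat_eq (h i)]

lemma comp_apply (ν : ℂ) {n m k : ℕ} (x : Tangle n m) (y : Tangle m k) (F : LinkDiagram n k) :
    comp ν x y F = ∑ p : LinkDiagram n m × LinkDiagram m k,
      x p.1 * y p.2 * concat ν p.1 p.2 F := by
  rw [comp, bilinExt, Finsupp.linearCombination_apply, Finsupp.sum_fintype _ _ (by simp),
    LinearMap.sum_apply, Finsupp.finsetSum_apply, Fintype.sum_prod_type]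
  refine Finset.sum_congr rfl fun D _ => ?_
  rw [LinearMap.smul_apply, Finsupp.linearCombination_apply, Finsupp.sum_fintype _ _ (by simp),
    Finsupp.smul_apply, Finsupp.finsetSum_apply, smul_eq_mul, Finset.mul_sum]
  exact Finset.sum_congr rfl fun E _ => by simp [mul_assoc]

lemma comp_stackTangle (ν : ℂ) (x y : ∀ i, Tangle (ς i) (ς i)) :
    comp ν (stackTangle x) (stackTangle y) = stackTangle fun i => comp ν (x i) (y i) := by
  have h1 : ∀ F : ∀ i, LinkDiagram (ς i) (ς i), ∏ i, comp ν (x i) (y i) (F i) =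
      ∑ D : (∀ i, LinkDiagram (ς i) (ς i)), ∑ E : (∀ i, LinkDiagram (ς i) (ς i)),
        (∏ i, x i (D i)) * (∏ i, y i (E i)) * ∏ i, concat ν (D i) (E i) (F i) := by
    intro F
    simp only [comp_apply, Fintype.sum_prod_type, Finset.prod_univ_sum, Fintype.piFinset_univ,
      Finset.prod_mul_distrib]
  simp only [stackTangle, h1, map_sum, LinearMap.sum_apply, comp_single_single, concat_stack,
    Finset.smul_sum, Finsupp.smul_single, smul_eq_mul]
  simp only [Finsupp.single_finsetSum]
  rw [Finset.sum_comm]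
  refine (Finset.sum_congr rfl fun D _ => Finset.sum_comm).trans ?_
  rw [Finset.sum_comm]

lemma stackTangle_eq_zero {x : ∀ i, Tangle (ς i) (ς i)} (j : Fin d) (h : x j = 0) :
    stackTangle x = 0 := by
  refine Finset.sum_eq_zero fun D _ => ?_
  rw [Finset.prod_eq_zero (Finset.mem_univ j) (by rw [h]; rfl), Finsupp.single_zero]

lemma flip_stackTangle (x : ∀ i, Tangle (ς i) (ς i)) :
    flip (stackTangle x) = stackTangle fun i => flip (x i) := by
  have h : ∀ {n m : ℕ} (x : Tangle n m) D, flip x (reflect D) = x D := by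
    intro n m x D
    exact Finsupp.mapDomain_apply (fun D E h => by rw [← reflect_reflect D, h, reflect_reflect]) x D
  let e : (∀ i, LinkDiagram (ς i) (ς i)) ≃ (∀ i, LinkDiagram (ς i) (ς i)) :=
    ⟨fun D i => reflect (D i), fun D i => reflect (D i),
      fun D => funext fun i => reflect_reflect _, fun D => funext fun i => reflect_reflect _⟩
  rw [stackTangle, map_sum, stackTangle]
  refine (Finset.sum_congr rfl fun D _ => ?_).trans (e.sum_comp fun D =>
    Finsupp.single (stack D) (∏ i, flip (x i) (D i)))
  rw [flip_single, reflect_stack]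
  simp only [e, Equiv.coe_fn_mk, h]

lemma turnDiagram_eq_stack (j : Fin d) (i : ℕ) (hi : i + 1 < ς j)
    (hi' : offset ς j + i + 1 < ∑ k, ς k) :
    turnDiagram (offset ς j + i) hi' =
      stack (Function.update (fun k => unitDiagram (ς k)) j (turnDiagram i hi)) := by
  refine ext_of_isColoring fun a b h => ?_
  rw [isColoring_turnDiagram] at h
  obtain ⟨h1, h2, h3⟩ := h
  rw [isColoring_stack]
  intro k
  by_cases hk : k = j
  · subst hk
    rw [Function.update_self, isColoring_turnDiagram]
    have h4 : ∀ (c : Fin (∑ i, ς i) → Bool) (u : Fin (ς k)) (t : Fin (∑ i, ς i)),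
        (t : ℕ) = offset ς k + u → block ς c k u = c t := by
      intro c u t ht
      exact congrArg c (Fin.ext (by rw [val_end, ht]))
    refine ⟨?_, ?_, fun u hu hu' => ?_⟩
    · rw [h4 a ⟨i, by omega⟩ ⟨offset ς k + i, by omega⟩ rfl,
        h4 a ⟨i + 1, hi⟩ ⟨offset ς k + i + 1, hi'⟩ (Nat.add_assoc _ _ _)]
      exact h1
    · rw [h4 b ⟨i, by omega⟩ ⟨offset ς k + i, by omega⟩ rfl,
        h4 b ⟨i + 1, hi⟩ ⟨offset ς k + i + 1, hi'⟩ (Nat.add_assoc _ _ _)]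
      exact h2
    · exact h3 _ (by rw [val_end]; omega) (by rw [val_end]; omega)
  · rw [Function.update_of_ne hk, isColoring_unitDiagram]
    funext u
    have h5 := val_end ς k u
    have h6 := u.2
    rcases lt_or_gt_of_ne hk with h4 | h4
    · have := offset_le ς h4
      exact h3 _ (by omega) (by omega)
    · have := offset_le ς h4
      exact h3 _ (by omega) (by omega)

lemma stack_unitDiagram : stack (fun i => unitDiagram (ς i)) = unitDiagram (∑ i, ς i) := by
  refine ext_of_isColoring fun a b h => ?_
  rw [isColoring_stack] at h
  rw [isColoring_unitDiagram]
  funext x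
  obtain ⟨⟨i, u⟩, rfl⟩ := finSigmaFinEquiv.surjective x
  exact congrFun ((isColoring_unitDiagram _ _).1 (h i)) u

/-- The ends at one valenced node are consecutive, so an innermost link beneath a loop link sits at
the same valenced node. -/
lemma HasLeftLoopLink.exists_adjacent {m : ℕ} {D : LinkDiagram (∑ i, ς i) m}
    (h : HasLeftLoopLink ς D) : ∃ (j : Fin d) (i : ℕ) (_ : i + 1 < ς j)
      (hi' : offset ς j + i + 1 < ∑ k, ς k),
      D.partner (Sum.inl ⟨offset ς j + i, by omega⟩) = Sum.inl ⟨offset ς j + i + 1, hi'⟩ := by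
  obtain ⟨x, y, hxy, hn⟩ := h
  obtain ⟨⟨j, u⟩, rfl⟩ := finSigmaFinEquiv.surjective x
  obtain ⟨⟨k, v⟩, rfl⟩ := finSigmaFinEquiv.surjective y
  simp only [node, Equiv.symm_apply_apply] at hn
  subst hn
  obtain ⟨i, hi, h1, h2, h3⟩ := exists_adjacent_link' D hxy
  rw [val_end, val_end] at h1 h2
  have hu := u.2
  have hv := v.2
  obtain ⟨i', rfl⟩ : ∃ i', i = offset ς j + i' := ⟨i - offset ς j, by omega⟩
  exact ⟨j, i', by omega, hi, h3⟩

lemma hasLeftLoopLink_stack {D : ∀ i, LinkDiagram (ς i) (ς i)} (h : D ≠ fun i => unitDiagram (ς i)) :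
    HasLeftLoopLink ς (stack D) := by
  obtain ⟨i, hi⟩ := Function.ne_iff.1 h
  obtain ⟨x, y, hxy⟩ := exists_left_link hi
  refine ⟨finSigmaFinEquiv ⟨i, x⟩, finSigmaFinEquiv ⟨i, y⟩, ?_, by simp [node]⟩
  show stackEquiv ς (stackPartner D ((stackEquiv ς).symm (stackEquiv ς ⟨i, Sum.inl x⟩))) =
    stackEquiv ς ⟨i, Sum.inl y⟩
  rw [Equiv.symm_apply_apply, stackPartner, hxy]

lemma hasLeftLoopLink_reflect {n : ℕ} {D : LinkDiagram n (∑ i, ς i)} :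
    HasLeftLoopLink ς (reflect D) ↔ HasRightLoopLink ς D := by
  simp only [HasLeftLoopLink, HasRightLoopLink, reflect_partner_inl]

lemma hasRightLoopLink_stack {D : ∀ i, LinkDiagram (ς i) (ς i)}
    (h : D ≠ fun i => unitDiagram (ς i)) : HasRightLoopLink ς (stack D) := by
  rw [← hasLeftLoopLink_reflect, reflect_stack]
  refine hasLeftLoopLink_stack fun e => h (funext fun i => ?_)
  rw [← reflect_reflect (D i), show reflect (D i) = _ from congrFun e i, reflect_unitDiagram]

end Stack

/-! ### The composite projector -/

/-- The Jones-Wenzl projectors of the sizes `ς i` exist, and `ν` does not vanish if one of them is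
not the unit. -/
structure HasProjectors (ν : ℂ) {d : ℕ} (ς : Fin d → ℕ) : Prop where
  isJonesWenzl : ∀ i, IsJonesWenzl ν (jonesWenzl ν (ς i))
  ne_zero : ∀ i, 2 ≤ ς i → ν ≠ 0

lemma hasProjectors {q : ℂ} (hq : q ≠ 0) {d : ℕ} {ς : Fin d → ℕ}
    (hς : ∀ i, (ς i : ℕ∞) < minPowerBar q) : HasProjectors (fugacity q) ς := by
  refine ⟨fun i => ?_, fun i hi h => ?_⟩
  · have h := exists_isJonesWenzl (ν := fugacity q) (s := ς i)
      fun k hk hks => quantumInt_ne_zero hq (hς i) hk hks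
    rw [jonesWenzl, dif_pos h]
    exact h.choose_spec
  · refine quantumInt_ne_zero hq (hς i) two_pos hi ?_
    simp [quantumInt, h]

namespace HasProjectors

variable {ν : ℂ} {d : ℕ} {ς : Fin d → ℕ} (H : HasProjectors ν ς)

include H

lemma comp_self : comp ν (compositeProjector ν ς) (compositeProjector ν ς) =
    compositeProjector ν ς := by
  rw [compositeProjector_eq, comp_stackTangle]
  congr 1
  funext i
  exact (H.isJonesWenzl i).2.1

lemma flip_eq : flip (compositeProjector ν ς) = compositeProjector ν ς := by
  rw [compositeProjector_eq, flip_stackTangle]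
  congr 1
  funext i
  exact (H.isJonesWenzl i).flip.unique (H.isJonesWenzl i) (H.ne_zero i)

/-- A generator inside one block is a stack with a single non-unit factor, and the projector of that
block kills this factor. -/
lemma comp_single_eq_zero {m : ℕ} {D : LinkDiagram (∑ i, ς i) m} (hD : HasLeftLoopLink ς D) :
    comp ν (compositeProjector ν ς) (Finsupp.single D 1) = 0 := by
  obtain ⟨j, i, hi, hi', h⟩ := hD.exists_adjacent
  refine comp_eq_zero_of_link (H.ne_zero j (by omega)) ?_ h 1
  have h1 : (Finsupp.single (turnDiagram (offset ς j + i) hi') 1 :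
      Tangle (∑ i, ς i) (∑ i, ς i)) = stackTangle fun k =>
        Finsupp.single (Function.update (fun k => unitDiagram (ς k)) j (turnDiagram i hi) k) 1 := by
    rw [stackTangle_single, turnDiagram_eq_stack, Finset.prod_const_one]
  rw [h1, compositeProjector_eq, comp_stackTangle]
  refine stackTangle_eq_zero j ?_
  rw [Function.update_self]
  exact ((H.isJonesWenzl j).2.2 i hi).2

lemma single_comp_eq_zero {m : ℕ} {D : LinkDiagram m (∑ i, ς i)} (hD : HasRightLoopLink ς D) :
    comp ν (Finsupp.single D 1) (compositeProjector ν ς) = 0 := by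
  rw [← flip_flip (comp ν _ _), flip_comp, flip_single, H.flip_eq,
    H.comp_single_eq_zero (hasLeftLoopLink_reflect.2 hD), map_zero]

/-- The composite projector is the unit plus stacks with some non-unit factor, and such a stack has
loop links on both sides. This is why the unit of the Temperley-Lieb algebra is still a unit for the
product with `P` inserted. -/
lemma map_eq {M : Type*} [AddCommGroup M] [Module ℂ M]
    (F : Tangle (∑ i, ς i) (∑ i, ς i) →ₗ[ℂ] M)
    (hF : ∀ D, HasLeftLoopLink ς D → HasRightLoopLink ς D → F (Finsupp.single D 1) = 0) :
    F (compositeProjector ν ς) = F (unitTangle _) := by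
  classical
  rw [compositeProjector_eq, stackTangle, map_sum,
    Finset.sum_eq_single fun i => unitDiagram (ς i)]
  · rw [stack_unitDiagram, unitTangle]
    congr 2
    exact Finset.prod_eq_one fun i _ => (H.isJonesWenzl i).unitCoeff_eq (H.ne_zero i)
  · intro D _ hD
    rw [single_eq_smul, map_smul, hF _ (hasLeftLoopLink_stack hD) (hasRightLoopLink_stack hD),
      smul_zero]
  · simp

end HasProjectors

/-! ### Opening and closing valenced nodes -/

lemma lsubtypeDomain_lmapDomain {α : Type*} (s : Set α) (x : s →₀ ℂ) :
    Finsupp.lsubtypeDomain (R := ℂ) s (Finsupp.lmapDomain ℂ ℂ (Subtype.val : s → α) x) = x := by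
  ext a
  exact Finsupp.mapDomain_apply Subtype.val_injective x a

lemma lsubtypeDomain_single_of_mem {α : Type*} {s : Set α} {a : α} (h : a ∈ s) (c : ℂ) :
    Finsupp.lsubtypeDomain (R := ℂ) s (Finsupp.single a c) = Finsupp.single ⟨a, h⟩ c := by
  rw [← lsubtypeDomain_lmapDomain s (Finsupp.single ⟨a, h⟩ c)]
  simp

lemma lsubtypeDomain_single_of_notMem {α : Type*} {s : Set α} {a : α} (h : a ∉ s) (c : ℂ) :
    Finsupp.lsubtypeDomain (R := ℂ) s (Finsupp.single a c) = 0 := by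
  ext b
  exact Finsupp.single_eq_of_ne fun e => h (e ▸ b.2)

/-- The form in which well-definedness on the quotient is used: passing to representatives only
loses basis vectors on which `F` vanishes. -/
lemma map_lmapDomain_lsubtypeDomain {α M : Type*} [AddCommGroup M] [Module ℂ M] (s : Set α)
    (F : (α →₀ ℂ) →ₗ[ℂ] M) (hF : ∀ a, a ∉ s → F (Finsupp.single a 1) = 0) (x : α →₀ ℂ) :
    F (Finsupp.lmapDomain ℂ ℂ (Subtype.val : s → α) (Finsupp.lsubtypeDomain (R := ℂ) s x)) =
      F x := by
  induction x using Finsupp.induction_linear with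
  | zero => simp
  | add f g hf hg => simp only [map_add, hf, hg]
  | single a c =>
    by_cases h : a ∈ s
    · rw [lsubtypeDomain_single_of_mem h]
      simp
    · rw [lsubtypeDomain_single_of_notMem h, map_zero, map_zero, single_eq_smul, map_smul, hF a h,
        smul_zero]

section Valenced

variable {d : ℕ} (ς : Fin d → ℕ)

lemma map_openTangle_closeTangle {M : Type*} [AddCommGroup M] [Module ℂ M]
    (F : Tangle (∑ i, ς i) (∑ i, ς i) →ₗ[ℂ] M)
    (hl : ∀ D, HasLeftLoopLink ς D → F (Finsupp.single D 1) = 0)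
    (hr : ∀ D, HasRightLoopLink ς D → F (Finsupp.single D 1) = 0)
    (x : Tangle (∑ i, ς i) (∑ i, ς i)) : F (openTangle ς (closeTangle ς x)) = F x := by
  refine map_lmapDomain_lsubtypeDomain {D | ¬ HasLeftLoopLink ς D ∧ ¬ HasRightLoopLink ς D} F ?_ x
  intro D hD
  by_cases h : HasLeftLoopLink ς D
  · exact hl D h
  · exact hr D (by_contra fun h' => hD ⟨h, h'⟩)

lemma closeTangle_openTangle (a : ValencedTangle ς) : closeTangle ς (openTangle ς a) = a :=
  lsubtypeDomain_lmapDomain {D | ¬ HasLeftLoopLink ς D ∧ ¬ HasRightLoopLink ς D} a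

lemma closeTangle_single_of_left {D : LinkDiagram (∑ i, ς i) (∑ i, ς i)}
    (h : HasLeftLoopLink ς D) (c : ℂ) : closeTangle ς (Finsupp.single D c) = 0 :=
  lsubtypeDomain_single_of_notMem (s := {D | ¬ HasLeftLoopLink ς D ∧ ¬ HasRightLoopLink ς D})
    (fun h' => h'.1 h) c

lemma closeTangle_single_of_right {D : LinkDiagram (∑ i, ς i) (∑ i, ς i)}
    (h : HasRightLoopLink ς D) (c : ℂ) : closeTangle ς (Finsupp.single D c) = 0 :=
  lsubtypeDomain_single_of_notMem (s := {D | ¬ HasLeftLoopLink ς D ∧ ¬ HasRightLoopLink ς D})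
    (fun h' => h'.2 h) c

lemma closeTangle_comp_of_left (ν : ℂ) {m : ℕ} {D : LinkDiagram (∑ i, ς i) m}
    (h : HasLeftLoopLink ς D) (c : ℂ) (x : Tangle m (∑ i, ς i)) :
    closeTangle ς (comp ν (Finsupp.single D c) x) = 0 := by
  induction x using Finsupp.induction_linear with
  | zero => simp
  | add f g hf hg => rw [map_add, map_add, hf, hg, add_zero]
  | single E a =>
    obtain ⟨G, l, hG⟩ := exists_colorMatrix_mul D E
    obtain ⟨x, y, hxy, hn⟩ := h
    rw [comp_single_eq hG, closeTangle_single_of_left ς ⟨x, y, concat_left_link hG hxy, hn⟩]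

lemma closeTangle_comp_of_right (ν : ℂ) {m : ℕ} {D : LinkDiagram m (∑ i, ς i)}
    (h : HasRightLoopLink ς D) (c : ℂ) (x : Tangle (∑ i, ς i) m) :
    closeTangle ς (comp ν x (Finsupp.single D c)) = 0 := by
  induction x using Finsupp.induction_linear with
  | zero => simp
  | add f g hf hg => rw [map_add, LinearMap.add_apply, map_add, hf, hg, add_zero]
  | single E a =>
    obtain ⟨G, l, hG⟩ := exists_colorMatrix_mul E D
    obtain ⟨x, y, hxy, hn⟩ := h
    rw [comp_single_eq hG, closeTangle_single_of_right ς ⟨x, y, concat_right_link hG hxy, hn⟩]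

/-- The diagram joins two of its right nodes. -/
def HasRightLink {n m : ℕ} (D : LinkDiagram n m) : Prop :=
  ∃ x y, D.partner (Sum.inr x) = Sum.inr y

lemma not_hasRightLink_iff {n m : ℕ} {D : LinkDiagram n m} :
    ¬ HasRightLink D ↔ ∀ j : Fin m, ∃ i : Fin n, D.partner (Sum.inr j) = Sum.inl i := by
  simp only [HasRightLink, not_exists]
  refine forall_congr' fun j => ?_
  rcases D.partner (Sum.inr j) with z | z <;> simp

lemma map_stateToTangle_dropTurnBacks {n s : ℕ} {M : Type*} [AddCommGroup M] [Module ℂ M]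
    (F : Tangle n s →ₗ[ℂ] M) (h : ∀ D, HasRightLink D → F (Finsupp.single D 1) = 0)
    (x : Tangle n s) : F (stateToTangle n s (dropTurnBacks n s x)) = F x :=
  map_lmapDomain_lsubtypeDomain
    {D : LinkDiagram n s | ∀ j : Fin s, ∃ i : Fin n, D.partner (Sum.inr j) = Sum.inl i} F
    (fun D hD => h D (by_contra fun h' => hD (not_hasRightLink_iff.1 h'))) x

variable (s : ℕ)

/-- A valenced link state as a tangle. -/
def stateTangle : ValencedState ς s →ₗ[ℂ] Tangle (∑ i, ς i) s :=
  stateToTangle _ s ∘ₗ openState ς s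

/-- The valenced link state of a tangle. -/
def tangleState : Tangle (∑ i, ς i) s →ₗ[ℂ] ValencedState ς s :=
  closeState ς s ∘ₗ dropTurnBacks _ s

lemma map_openState_closeState {M : Type*} [AddCommGroup M] [Module ℂ M]
    (F : LinkState (∑ i, ς i) s →ₗ[ℂ] M)
    (h : ∀ α : LinkPattern (∑ i, ς i) s, HasLeftLoopLink ς α.1 → F (Finsupp.single α 1) = 0)
    (x : LinkState (∑ i, ς i) s) : F (openState ς s (closeState ς s x)) = F x :=
  map_lmapDomain_lsubtypeDomain {α : LinkPattern (∑ i, ς i) s | ¬ HasLeftLoopLink ς α.1} F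
    (fun α hα => h α (not_not.1 hα)) x

lemma map_stateTangle_tangleState {M : Type*} [AddCommGroup M] [Module ℂ M]
    (F : Tangle (∑ i, ς i) s →ₗ[ℂ] M)
    (hl : ∀ D, HasLeftLoopLink ς D → F (Finsupp.single D 1) = 0)
    (hr : ∀ D, HasRightLink D → F (Finsupp.single D 1) = 0) (x : Tangle (∑ i, ς i) s) :
    F (stateTangle ς s (tangleState ς s x)) = F x := by
  rw [← map_stateToTangle_dropTurnBacks F hr x]
  refine map_openState_closeState ς s (F ∘ₗ stateToTangle _ s) (fun α hα => ?_) _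
  rw [LinearMap.comp_apply, stateToTangle, Finsupp.lmapDomain_apply, Finsupp.mapDomain_single]
  exact hl _ hα

lemma tangleState_stateTangle (v : ValencedState ς s) :
    tangleState ς s (stateTangle ς s v) = v := by
  have h1 : ∀ w : LinkState (∑ i, ς i) s, dropTurnBacks _ s (stateToTangle _ s w) = w :=
    fun w => lsubtypeDomain_lmapDomain {D : LinkDiagram (∑ i, ς i) s |
      ∀ j : Fin s, ∃ i : Fin (∑ i, ς i), D.partner (Sum.inr j) = Sum.inl i} w
  rw [tangleState, stateTangle, LinearMap.comp_apply, LinearMap.comp_apply, h1]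
  exact lsubtypeDomain_lmapDomain {α : LinkPattern (∑ i, ς i) s | ¬ HasLeftLoopLink ς α.1} v

lemma tangleState_single_of_right {D : LinkDiagram (∑ i, ς i) s} (h : HasRightLink D) (c : ℂ) :
    tangleState ς s (Finsupp.single D c) = 0 := by
  have h1 : dropTurnBacks _ s (Finsupp.single D c) = 0 :=
    lsubtypeDomain_single_of_notMem (s := {D : LinkDiagram (∑ i, ς i) s |
      ∀ j : Fin s, ∃ i : Fin (∑ i, ς i), D.partner (Sum.inr j) = Sum.inl i})
      (fun h' => not_hasRightLink_iff.2 h' h) c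
  rw [tangleState, LinearMap.comp_apply, h1, map_zero]

lemma tangleState_single_of_left {D : LinkDiagram (∑ i, ς i) s} (h : HasLeftLoopLink ς D) (c : ℂ) :
    tangleState ς s (Finsupp.single D c) = 0 := by
  by_cases hD : HasRightLink D
  · exact tangleState_single_of_right ς s hD c
  · have h1 : dropTurnBacks _ s (Finsupp.single D c) =
        Finsupp.single (⟨D, not_hasRightLink_iff.1 hD⟩ : LinkPattern (∑ i, ς i) s) c :=
      lsubtypeDomain_single_of_mem (s := {D : LinkDiagram (∑ i, ς i) s |
        ∀ j : Fin s, ∃ i : Fin (∑ i, ς i), D.partner (Sum.inr j) = Sum.inl i})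
        (not_hasRightLink_iff.1 hD) c
    rw [tangleState, LinearMap.comp_apply, h1]
    exact lsubtypeDomain_single_of_notMem
      (s := {α : LinkPattern (∑ i, ς i) s | ¬ HasLeftLoopLink ς α.1}) (fun h' => h' h) c

lemma tangleState_comp_of_left (ν : ℂ) {m : ℕ} {D : LinkDiagram (∑ i, ς i) m}
    (h : HasLeftLoopLink ς D) (c : ℂ) (x : Tangle m s) :
    tangleState ς s (comp ν (Finsupp.single D c) x) = 0 := by
  induction x using Finsupp.induction_linear with
  | zero => simp
  | add f g hf hg => rw [map_add, map_add, hf, hg, add_zero]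
  | single E a =>
    obtain ⟨G, l, hG⟩ := exists_colorMatrix_mul D E
    obtain ⟨x, y, hxy, hn⟩ := h
    rw [comp_single_eq hG, tangleState_single_of_left ς s ⟨x, y, concat_left_link hG hxy, hn⟩]

lemma tangleState_comp_of_right (ν : ℂ) {m : ℕ} {D : LinkDiagram m s} (h : HasRightLink D) (c : ℂ)
    (x : Tangle (∑ i, ς i) m) : tangleState ς s (comp ν x (Finsupp.single D c)) = 0 := by
  induction x using Finsupp.induction_linear with
  | zero => simp
  | add f g hf hg => rw [map_add, LinearMap.add_apply, map_add, hf, hg, add_zero]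
  | single E a =>
    obtain ⟨G, l, hG⟩ := exists_colorMatrix_mul E D
    obtain ⟨x, y, hxy⟩ := h
    rw [comp_single_eq hG, tangleState_single_of_right ς s ⟨x, y, concat_right_link hG hxy⟩]

end Valenced

/-! ### The form as a coefficient -/

/-- The concatenation leaves a diagram on `s` strands, and the absence of turn-back paths means that
this diagram is the unit. The form thus becomes a linear functional of a product of tangles. -/
lemma network_eq (ν : ℂ) {n s : ℕ} (α β : LinkPattern n s) :
    network ν α β = unitCoeff s (concat ν (reflect α.1) β.1) := by
  obtain ⟨D, l, hD⟩ := exists_colorMatrix_mul (reflect α.1) β.1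
  have hc := isConcat_of_colorMatrix hD
  have h : HasTurnBack α β ↔ D ≠ unitDiagram s := by
    constructor
    · rintro ⟨i, j, hij, h | h⟩
      · exact ne_unitDiagram_of_left_link ((hc (Sum.inl i) (Sum.inl j)).2
          ⟨fun e => hij (Sum.inl.inj e), h⟩)
      · exact ne_unitDiagram_of_right_link ((hc (Sum.inr i) (Sum.inr j)).2
          ⟨fun e => hij (Sum.inr.inj e), h⟩)
    · intro h
      obtain ⟨x, y, hxy⟩ := exists_left_link h
      have := (hc _ _).1 hxy
      exact ⟨x, y, fun e => this.1 (congrArg _ e), Or.inl this.2⟩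
  rw [concat_eq hD, network, numLoops_of_colorMatrix hD]
  by_cases hu : D = unitDiagram s
  · rw [if_neg (by rw [h]; simpa using hu), hu]
    simp [unitCoeff]
  · rw [if_pos (h.2 hu), unitCoeff_single_of_ne hu]

lemma form_eq (ν : ℂ) {n s : ℕ} (v w : LinkState n s) :
    form ν n s v w = unitCoeff s (comp ν (flip (stateToTangle n s v)) (stateToTangle n s w)) := by
  induction v using Finsupp.induction_linear with
  | zero => simp
  | add f g hf hg => simp only [map_add, LinearMap.add_apply, hf, hg]
  | single α x =>
  induction w using Finsupp.induction_linear with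
  | zero => simp
  | add f g hf hg => simp only [map_add, hf, hg]
  | single β y =>
  simp only [stateToTangle, Finsupp.lmapDomain_apply, Finsupp.mapDomain_single]
  rw [flip_single, comp_single_single, map_smul, ← network_eq]
  simp [form, bilinExt, mul_assoc]

lemma unitCoeff_flip {s : ℕ} (x : Tangle s s) : unitCoeff s (flip x) = unitCoeff s x := by
  have h := map_eq_unitCoeff_smul (unitCoeff s ∘ₗ flip) (fun D hD => ?_) x
  · rwa [LinearMap.comp_apply, LinearMap.comp_apply, flip_unitTangle, unitCoeff_unitTangle,
      smul_eq_mul, mul_one] at h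
  · rw [LinearMap.comp_apply, flip_single, unitCoeff_single_of_ne fun e => hD ?_]
    rw [← reflect_reflect D, e, reflect_unitDiagram]

lemma unitCoeff_flip_comp_single {n s : ℕ} (ν : ℂ) {D : LinkDiagram n s} (h : HasRightLink D)
    (c : ℂ) (y : Tangle n s) : unitCoeff s (comp ν (flip (Finsupp.single D c)) y) = 0 := by
  obtain ⟨i, j, hij⟩ := h
  rw [flip_single, unitCoeff_single_comp ν ((reflect_partner_inl D i j).2 hij)]

/-! ### Module axioms, invariance of the form and rank-one operators. -/

namespace HasProjectors

variable {ν : ℂ} {d : ℕ} {ς : Fin d → ℕ} (s : ℕ)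

lemma act_apply (a : ValencedTangle ς) (v : ValencedState ς s) : act ν ς s a v =
    tangleState ς s (comp ν (openTangle ς a)
      (comp ν (compositeProjector ν ς) (stateTangle ς s v))) :=
  map_stateToTangle_dropTurnBacks (tangleState ς s ∘ₗ comp ν (openTangle ς a))
    (fun _ hD => tangleState_comp_of_right ς s ν hD 1 _) _

lemma mul_apply (a b : ValencedTangle ς) : mul ν ς a b = closeTangle ς (comp ν (openTangle ς a)
    (comp ν (compositeProjector ν ς) (openTangle ς b))) := rfl

lemma openTangle_one : openTangle ς (one ς) = unitTangle _ := by
  rw [openTangle, one, Finsupp.lmapDomain_apply, Finsupp.mapDomain_single]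
  rfl

variable (H : HasProjectors ν ς)

include H

/-- Turn-back paths cannot contribute to the unit coefficient, so they need not be dropped
beforehand; and the two projectors merge into one, as `P` is an idempotent fixed by reflection. -/
lemma valencedForm_apply (v w : ValencedState ς s) : valencedForm ν ς s v w =
    unitCoeff s (comp ν (flip (stateTangle ς s v))
      (comp ν (compositeProjector ν ς) (stateTangle ς s w))) := by
  have h1 : valencedForm ν ς s v w = form ν _ s (embed ν ς s v) (embed ν ς s w) := rfl
  have h2 : ∀ u, embed ν ς s u = dropTurnBacks _ s
    (comp ν (compositeProjector ν ς) (stateTangle ς s u)) := fun u => rfl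
  rw [h1, form_eq, h2, h2]
  have h3 : ∀ x y : Tangle (∑ i, ς i) s, unitCoeff s (comp ν
      (flip (stateToTangle _ s (dropTurnBacks _ s x))) y) = unitCoeff s (comp ν (flip x) y) :=
    fun x y => map_stateToTangle_dropTurnBacks (unitCoeff s ∘ₗ (comp ν).flip y ∘ₗ flip)
      (fun D hD => unitCoeff_flip_comp_single ν hD 1 y) x
  have h4 : ∀ (x : Tangle s (∑ i, ς i)) (y : Tangle (∑ i, ς i) s), unitCoeff s (comp ν x
      (stateToTangle _ s (dropTurnBacks _ s y))) = unitCoeff s (comp ν x y) :=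
    fun x y => map_stateToTangle_dropTurnBacks (unitCoeff s ∘ₗ comp ν x)
      (fun D ⟨i, j, hij⟩ => unitCoeff_comp_single ν hij 1 x) y
  rw [h3, h4, flip_comp, H.flip_eq, comp_assoc, ← comp_assoc ν (compositeProjector ν ς),
    H.comp_self]

lemma isModuleOver : IsModuleOver (mul ν ς) (one ς) (act ν ς s) where
  mul_assoc a b c := by
    simp only [mul_apply]
    set P := compositeProjector ν ς
    set x := openTangle ς a
    set y := openTangle ς b
    set z := openTangle ς c
    -- Closing the inner product loses nothing: a left loop link would persist and be discarded at
    -- the end, and a right one is killed by the next projector.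
    have h1 := map_openTangle_closeTangle ς (closeTangle ς ∘ₗ (comp ν).flip (comp ν P z))
      (fun D hD => closeTangle_comp_of_left ς ν hD 1 _) (fun D hD => by
        rw [LinearMap.comp_apply, LinearMap.flip_apply, ← comp_assoc, H.single_comp_eq_zero hD]
        simp) (comp ν x (comp ν P y))
    have h2 := map_openTangle_closeTangle ς (closeTangle ς ∘ₗ comp ν x ∘ₗ comp ν P)
      (fun D hD => by
        rw [LinearMap.comp_apply, LinearMap.comp_apply, H.comp_single_eq_zero hD]
        simp) (fun D hD => by
        rw [LinearMap.comp_apply, LinearMap.comp_apply, ← comp_assoc]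
        exact closeTangle_comp_of_right ς ν hD 1 _) (comp ν y (comp ν P z))
    simp only [LinearMap.comp_apply, LinearMap.flip_apply] at h1 h2
    rw [h1, h2]
    simp only [comp_assoc]
  one_mul a := by
    rw [mul_apply, openTangle_one, unitTangle_comp]
    have h := H.map_eq (closeTangle ς ∘ₗ (comp ν).flip (openTangle ς a))
      fun D hD _ => closeTangle_comp_of_left ς ν hD 1 _
    simp only [LinearMap.comp_apply, LinearMap.flip_apply] at h
    rw [h, unitTangle_comp, closeTangle_openTangle]
  mul_one a := by
    rw [mul_apply, openTangle_one, comp_unitTangle]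
    have h := H.map_eq (closeTangle ς ∘ₗ comp ν (openTangle ς a))
      fun D _ hD => closeTangle_comp_of_right ς ν hD 1 _
    simp only [LinearMap.comp_apply] at h
    rw [h, comp_unitTangle, closeTangle_openTangle]
  act_mul a b v := by
    simp only [act_apply, mul_apply]
    set P := compositeProjector ν ς
    set x := openTangle ς a
    set y := openTangle ς b
    set z := stateTangle ς s v
    have h1 := map_openTangle_closeTangle ς (tangleState ς s ∘ₗ (comp ν).flip (comp ν P z))
      (fun D hD => tangleState_comp_of_left ς s ν hD 1 _) (fun D hD => by
        rw [LinearMap.comp_apply, LinearMap.flip_apply, ← comp_assoc, H.single_comp_eq_zero hD]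
        simp) (comp ν x (comp ν P y))
    have h2 := map_stateTangle_tangleState ς s (tangleState ς s ∘ₗ comp ν x ∘ₗ comp ν P)
      (fun D hD => by
        rw [LinearMap.comp_apply, LinearMap.comp_apply, H.comp_single_eq_zero hD]
        simp) (fun D hD => by
        rw [LinearMap.comp_apply, LinearMap.comp_apply, ← comp_assoc]
        exact tangleState_comp_of_right ς s ν hD 1 _) (comp ν y (comp ν P z))
    simp only [LinearMap.comp_apply, LinearMap.flip_apply] at h1 h2
    rw [h1, h2]
    simp only [comp_assoc]
  act_one v := by
    rw [act_apply, openTangle_one, unitTangle_comp]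
    have h := H.map_eq (tangleState ς s ∘ₗ (comp ν).flip (stateTangle ς s v))
      fun D hD _ => tangleState_comp_of_left ς s ν hD 1 _
    simp only [LinearMap.comp_apply, LinearMap.flip_apply] at h
    rw [h, unitTangle_comp, tangleState_stateTangle]

lemma valencedForm_symm (v w : ValencedState ς s) :
    valencedForm ν ς s v w = valencedForm ν ς s w v := by
  rw [H.valencedForm_apply, ← unitCoeff_flip, flip_comp, flip_comp, flip_flip, H.flip_eq,
    comp_assoc, ← H.valencedForm_apply]

lemma unitCoeff_eq_valencedForm (v : ValencedState ς s) (x : Tangle (∑ i, ς i) s) :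
    unitCoeff s (comp ν (flip (stateTangle ς s v)) (comp ν (compositeProjector ν ς) x)) =
      valencedForm ν ς s v (tangleState ς s x) := by
  rw [H.valencedForm_apply]
  refine (map_stateTangle_tangleState ς s (unitCoeff s ∘ₗ comp ν (flip (stateTangle ς s v)) ∘ₗ
    comp ν (compositeProjector ν ς)) (fun D hD => ?_) (fun D ⟨i, j, hij⟩ => ?_) x).symm
  · rw [LinearMap.comp_apply, LinearMap.comp_apply, H.comp_single_eq_zero hD]
    simp
  · rw [LinearMap.comp_apply, LinearMap.comp_apply, ← comp_assoc]
    exact unitCoeff_comp_single ν hij 1 _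

lemma isSubmodule_radical : IsSubmodule (act ν ς s) (radical ν ς s) := by
  intro a v hv
  have hv : valencedForm ν ς s v = 0 := hv
  show valencedForm ν ς s _ = 0
  refine LinearMap.ext fun w => ?_
  -- Reflection moves the tangle to the other argument: with `x` the opened tangle of `a`, `(w | a
  -- v)` equals `(v | x† P w)`, which vanishes for `v` in the radical.
  rw [H.valencedForm_symm, act_apply, ← H.unitCoeff_eq_valencedForm, ← unitCoeff_flip]
  simp only [flip_comp, flip_flip, H.flip_eq, comp_assoc]
  rw [H.unitCoeff_eq_valencedForm, hv]
  rfl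

/-- The tangle made of a link state and a reflected link state acts as a rank-one map. -/
lemma act_stateTangle_flip (u v w : ValencedState ς s) :
    act ν ς s (closeTangle ς (comp ν (stateTangle ς s u) (flip (stateTangle ς s v)))) w =
      valencedForm ν ς s v w • u := by
  rw [act_apply]
  set P := compositeProjector ν ς
  have h1 := map_openTangle_closeTangle ς (tangleState ς s ∘ₗ (comp ν).flip
    (comp ν P (stateTangle ς s w)))
    (fun D hD => tangleState_comp_of_left ς s ν hD 1 _) (fun D hD => by
      rw [LinearMap.comp_apply, LinearMap.flip_apply, ← comp_assoc, H.single_comp_eq_zero hD]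
      simp) (comp ν (stateTangle ς s u) (flip (stateTangle ς s v)))
  simp only [LinearMap.comp_apply, LinearMap.flip_apply] at h1
  rw [h1, comp_assoc]
  -- A non-unit diagram in the middle factor joins two of the `s` defects, and this turn-back makes
  -- the state zero; only the scalar `(v | w)` remains.
  have h2 := map_eq_unitCoeff_smul (tangleState ς s ∘ₗ comp ν (stateTangle ς s u))
    (fun D hD => tangleState_comp_of_right ς s ν (exists_right_link hD) 1 _)
    (comp ν (flip (stateTangle ς s v)) (comp ν P (stateTangle ς s w)))
  simp only [LinearMap.comp_apply] at h2
  rw [h2, comp_unitTangle, tangleState_stateTangle, ← H.valencedForm_apply]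

/-- If `(v | w) ≠ 0` for some `w` in `W`, the rank-one tangles `u v†` carry `w` to nonzero multiples
of every `u`, so `W` would be everything. -/
lemma le_radical {W : Submodule ℂ (ValencedState ς s)} (hW : IsSubmodule (act ν ς s) W)
    (h : W ≠ ⊤) : W ≤ radical ν ς s := by
  intro w hw
  by_contra hwr
  have h1 : ∃ v, valencedForm ν ς s w v ≠ 0 := by
    by_contra h2
    push Not at h2
    exact hwr (LinearMap.ext h2)
  obtain ⟨v, hv⟩ := h1
  rw [H.valencedForm_symm] at hv
  refine h (Submodule.eq_top_iff'.2 fun u => ?_)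
  have h3 := hW (closeTangle ς (comp ν (stateTangle ς s u) (flip (stateTangle ς s v)))) w hw
  rw [H.act_stateTangle_flip s u v w] at h3
  exact (Submodule.smul_mem_iff _ hv).1 h3

end HasProjectors

end ValencedTL

end

/-! ### The proposition, deduced from the fact that proper submodules lie in the radical. -/

theorem mainTheorem7 (q : ℂ) (hq : q ≠ 0) {d : ℕ} (ς : Fin d → ℕ) (s : ℕ)
    (hς : ∀ i, (ς i : ℕ∞) < ValencedTL.minPowerBar q)
    (hrad : ValencedTL.radical (ValencedTL.fugacity q) ς s ≠ ⊤) :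
    ValencedTL.IsModuleOver (ValencedTL.mul (ValencedTL.fugacity q) ς) (ValencedTL.one ς)
        (ValencedTL.act (ValencedTL.fugacity q) ς s) ∧
      (∃ h : ValencedTL.IsSubmodule (ValencedTL.act (ValencedTL.fugacity q) ς s)
          (ValencedTL.radical (ValencedTL.fugacity q) ς s),
        ValencedTL.IsSimple (ValencedTL.quotientAct (ValencedTL.act (ValencedTL.fugacity q) ς s)
          (ValencedTL.radical (ValencedTL.fugacity q) ς s) h)) ∧
      (∀ W : Submodule ℂ (ValencedTL.ValencedState ς s),
        ValencedTL.IsMaximalProper (ValencedTL.act (ValencedTL.fugacity q) ς s) W ↔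
          W = ValencedTL.radical (ValencedTL.fugacity q) ς s) ∧
      ValencedTL.IsIndecomposable (ValencedTL.act (ValencedTL.fugacity q) ς s) := by
  have H := ValencedTL.hasProjectors hq hς
  have hsub := H.isSubmodule_radical s
  refine ⟨H.isModuleOver s, ⟨hsub, Submodule.Quotient.nontrivial_iff.2 hrad, fun W hW => ?_⟩,
    fun W => ⟨fun ⟨h1, h2, h3⟩ => ?_, ?_⟩, ?_, fun U W hU hW hUW => ?_⟩
  -- The preimage of `W` is a submodule of the standard module: it is everything, or it lies in the
  -- radical and `W` is zero.
  · by_cases h : W.comap (Submodule.mkQ _) = ⊤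
    · right
      rw [← Submodule.map_comap_eq_of_surjective (Submodule.mkQ_surjective _) W, h,
        Submodule.map_top, Submodule.range_mkQ]
    · left
      have h1 := H.le_radical s (fun a v hv => hW a _ hv) h
      rw [← Submodule.map_comap_eq_of_surjective (Submodule.mkQ_surjective _) W, eq_bot_iff,
        Submodule.map_le_iff_le_comap]
      intro v hv
      exact (Submodule.Quotient.mk_eq_zero _).2 (h1 hv)
  · exact (h3 _ hsub (H.le_radical s h1 h2) hrad).symm
  · rintro rfl
    exact ⟨hsub, hrad, fun W' h1 h2 h3 => le_antisymm (H.le_radical s h1 h3) h2⟩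
  · by_contra h
    rw [not_nontrivial_iff_subsingleton] at h
    exact hrad (Subsingleton.elim _ _)
  · by_contra! h
    -- Two nonzero complements are both proper, hence both in the radical, and so is their sum,
    -- which is the whole module.
    refine hrad (top_le_iff.1 (hUW.sup_eq_top.symm.le.trans (sup_le ?_ ?_)))
    · refine H.le_radical s hU fun e => h.2 ?_
      rw [e] at hUW
      exact top_disjoint.1 hUW.disjoint
    · refine H.le_radical s hW fun e => h.1 ?_
      rw [e] at hUW
      exact disjoint_top.1 hUW.disjoint
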